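/- **Theorem 4.1 ($Y$-graph).** Let $Y$ be the $Y$-graph: three arms of positive (finite) lengths $\ell_0,\ell_1,\ell_2$ glued at one end of each to a common vertex $v$, with its path metric. Let $F(Y,2)=\{(a,a')\in Y\times Y: a\neq a'\}$ with the metric $d((a,a'),(b,b'))=\sqrt{d(a,b)^2+d(a',b')^2}$, and let $F_I(Y,2)$ be the same set with the intrinsic metric $d_I(x,y)$, the infimum of the $d$-lengths of paths in $F(Y,2)$ from $x$ to $y$ (which is finite). Then the completion of $F_I(Y,2)$ is a geodesic space, and $$\mathrm{GC}(F_I(Y,2))=\mathrm{TC}(F(Y,2))=1.$$ Here $I=[0,1]$, the length of a path is the supremum of the sums of distances between successive points on it, a geodesic from $x_0$ to $x_1$ is a path from $x_0$ to $x_1$ whose length is the distance between them, and a metric space is geodesic if any two of its points are joined by a geodesic. Path spaces carry the compact-open topology. * $\mathrm{TC}(X)$ is the smallest $k$ such that $X\times X$ is covered by $k+1$ open sets $U$ on each of which there is a continuous map $U\to X^I$ sending each $(x_0,x_1)$ to a path in $X$ from $x_0$ to $x_1$. * Let $X$ be a metric space whose completion $\overline X$ is geodesic. For $x_0,x_1\in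 X$, a near-geodesic from $x_0$ to $x_1$ is a continuous map $\phi$ from $I$ to the space of paths in $\overline X$ from $x_0$ to $x_1$ such that $\phi(0)$ is a geodesic in $\overline X$, $\phi(s)$ is a path in $X$ for all $s\in(0,1]$, and $\mathrm{length}(\phi(s_n))\to\mathrm{length}(\phi(0))$ whenever $s_n\to0$. For $E\subset X\times X$, a near-geodesic motion planning rule on $E$ is a continuous map $\Phi:E\to(\overline X^{\,I})^I$ such that, for all $(x_0,x_1)\in E$, $\Phi(x_0,x_1)$ is a near-geodesic from $x_0$ to $x_1$, and $\Phi(x_0,x_1)(0)$ is a geodesic in $X$ if there is a geodesic in $X$ from $x_0$ to $x_1$. $\mathrm{GC}(X)$ is the smallest $k$ such that $X\times X$ can be partitioned into locally compact sets $E_0,\dots,E_k$ each of which has a near-geodesic motion planning rule. -/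

import Mathlib

namespace GeoComp

open Set Filter Topology unitInterval
open scoped ENNReal NNReal

/-- The length of a path (a map on the unit interval): the supremum of the sums of the distances
between successive points. -/
noncomputable def pathLength {X : Type*} [PseudoEMetricSpace X] (γ : I → X) : ℝ≥0∞ :=
  eVariationOn γ univ

/-- A (minimal) geodesic: a path whose length is the distance between its endpoints. -/
def IsGeodesic {X : Type*} [PseudoEMetricSpace X] (γ : C(I, X)) : Prop :=
  pathLength γ = edist (γ 0) (γ 1)

/-- A path in `X` from `x` to `y`, as an element of the space `C(I, X)` of free paths. -/
def Joins {X : Type*} [TopologicalSpace X] (γ : C(I, X)) (x y : X) : Prop :=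
  γ 0 = x ∧ γ 1 = y

/-- Any two points are joined by a geodesic. -/
def IsGeodesicSpace (X : Type*) [MetricSpace X] : Prop :=
  ∀ x y : X, ∃ γ : C(I, X), Joins γ x y ∧ IsGeodesic γ

/-! ### Topological complexity -/

/-- A continuous motion planning rule on a set of pairs of points. -/
def HasMotionPlan {X : Type*} [TopologicalSpace X] (E : Set (X × X)) : Prop :=
  ∃ f : C(E, C(I, X)), ∀ e : E, Joins (f e) e.1.1 e.1.2

/-- The (reduced) topological complexity: the smallest `k` such that `X × X` is covered
by `k + 1` open sets, each of which has a motion planning rule (`⊤` if there is none). -/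
noncomputable def topComplexity (X : Type*) [TopologicalSpace X] : ℕ∞ :=
  ⨅ (k : ℕ) (_ : ∃ U : Fin (k + 1) → Set (X × X),
    (∀ i, IsOpen (U i)) ∧ (⋃ i, U i) = univ ∧ ∀ i, HasMotionPlan (U i)), (k : ℕ∞)

/-! ### Geodesic complexity through near-geodesics -/

/-- A near-geodesic from `x` to `y`: a homotopy of paths from `x` to `y` in the completion that
starts at a geodesic of the completion, consists of paths of `X` at positive parameters, and along
which the length converges to the length of that geodesic as the parameter tends to `0`. -/
structure IsNearGeodesic {X : Type*} [MetricSpace X] (x y : X)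
    (φ : C(I, C(I, UniformSpace.Completion X))) : Prop where
  joins : ∀ s, Joins (φ s) (x : UniformSpace.Completion X) (y : UniformSpace.Completion X)
  geodesic_zero : IsGeodesic (φ 0)
  path_of_pos : ∀ s : I, 0 < s →
    ∃ γ : C(I, X), Joins γ x y ∧ ∀ t, φ s t = (γ t : UniformSpace.Completion X)
  tendsto_length : ∀ u : ℕ → I, Tendsto u atTop (𝓝 0) →
    Tendsto (fun n => pathLength (φ (u n))) atTop (𝓝 (pathLength (φ 0)))

/-- A near-geodesic motion planning rule on `E`: a near-geodesic from `x` to `y` for each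
`(x, y) ∈ E`, depending continuously on the pair, whose initial path is a geodesic in `X`
whenever there is a geodesic in `X` from `x` to `y`. -/
def IsNGMPR {X : Type*} [MetricSpace X] (E : Set (X × X))
    (Φ : C(E, C(I, C(I, UniformSpace.Completion X)))) : Prop :=
  ∀ e : E, IsNearGeodesic e.1.1 e.1.2 (Φ e) ∧
    ((∃ γ : C(I, X), Joins γ e.1.1 e.1.2 ∧ IsGeodesic γ) →
      ∃ γ : C(I, X), Joins γ e.1.1 e.1.2 ∧ IsGeodesic γ ∧
        ∀ t, Φ e 0 t = (γ t : UniformSpace.Completion X))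

/-- The geodesic complexity of a metric space (with geodesic completion): the smallest `k` such
that `X × X` is partitioned into locally compact sets `E 0, …, E k`, each of which has a
near-geodesic motion planning rule (`⊤` if there is none). -/
noncomputable def geodComplexity (X : Type*) [MetricSpace X] : ℕ∞ :=
  ⨅ (k : ℕ) (_ : ∃ E : Fin (k + 1) → Set (X × X),
    Pairwise (fun i j => Disjoint (E i) (E j)) ∧ (⋃ i, E i) = univ ∧
    ∀ i, LocallyCompactSpace (E i) ∧ ∃ Φ, IsNGMPR (E i) Φ), (k : ℕ∞)

/-! ### The intrinsic metric -/

/-- The infimum of the lengths of the paths from `x` to `y`. -/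
noncomputable def intrinsicEDist {X : Type*} [PseudoEMetricSpace X] (x y : X) : ℝ≥0∞ :=
  ⨅ γ : Path x y, pathLength γ

/-- Any two points are joined by a path of finite length. -/
class RectifiablyConnected (X : Type*) [PseudoEMetricSpace X] : Prop where
  exists_path : ∀ x y : X, ∃ γ : Path x y, pathLength γ ≠ ⊤

section Intrinsic

variable {X : Type*} [PseudoEMetricSpace X]

theorem edist_le_intrinsicEDist (x y : X) : edist x y ≤ intrinsicEDist x y := by
  refine le_iInf fun γ => ?_
  have h := eVariationOn.edist_le (γ : I → X) (mem_univ (0 : I)) (mem_univ (1 : I))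
  rwa [γ.source, γ.target] at h

theorem intrinsicEDist_self (x : X) : intrinsicEDist x x = 0 := by
  refine le_antisymm ((iInf_le _ (Path.refl x)).trans (le_of_eq ?_)) zero_le
  exact eVariationOn.constant_on (f := (Path.refl x : I → X)) (by
    rintro _ ⟨a, -, rfl⟩ _ ⟨b, -, rfl⟩; rfl)

theorem pathLength_symm {x y : X} (γ : Path x y) : pathLength γ.symm = pathLength γ := by
  have key : ∀ {x y : X} (γ : Path x y), pathLength γ.symm ≤ pathLength γ := by
    intro x y γ
    refine eVariationOn.comp_le_of_antitoneOn (γ : I → X) σ (t := univ) (s := univ) ?_ ?_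
    · intro a _ b _ hab
      exact unitInterval.symm_le_symm.2 hab
    · intro a _; exact mem_univ _
  refine le_antisymm (key γ) ?_
  simpa using key γ.symm

theorem pathLength_trans_le {x y z : X} (γ : Path x y) (γ' : Path y z) :
    pathLength (γ.trans γ') ≤ pathLength γ + pathLength γ' := by
  let h : I := ⟨1 / 2, by norm_num, by norm_num⟩
  have hsplit : pathLength (γ.trans γ') =
      eVariationOn (γ.trans γ') (Iic h) + eVariationOn (γ.trans γ') (Ici h) := by
    rw [← eVariationOn.union _ (isGreatest_Iic (a := h)) (isLeast_Ici (a := h)), Iic_union_Ici]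
    rfl
  rw [hsplit]
  refine add_le_add ?_ ?_
  · have h1 : EqOn (γ.trans γ')
        (γ ∘ fun t : I => projIcc (0 : ℝ) 1 zero_le_one (2 * t)) (Iic h) := by
      intro t ht
      have ht' : (t : ℝ) ≤ 1 / 2 := ht
      simp only [Path.trans_apply, dif_pos ht', Function.comp]
      congr 1
      rw [projIcc_of_mem]
    rw [eVariationOn.congr h1]
    refine eVariationOn.comp_le_of_monotoneOn _ _ ?_ (fun _ _ => mem_univ _)
    intro a _ b _ hab
    exact monotone_projIcc _ (mul_le_mul_of_nonneg_left (Subtype.coe_le_coe.2 hab) zero_le_two)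
  · have h1 : EqOn (γ.trans γ')
        (γ' ∘ fun t : I => projIcc (0 : ℝ) 1 zero_le_one (2 * t - 1)) (Ici h) := by
      intro t ht
      have ht' : 1 / 2 ≤ (t : ℝ) := ht
      rcases ht'.eq_or_lt with he | hlt
      · have : t = h := Subtype.ext he.symm
        subst this
        simp [Path.trans_apply, h, Function.comp]
      · simp only [Path.trans_apply, dif_neg (not_le.2 hlt), Function.comp]
        congr 1
        rw [projIcc_of_mem]
    rw [eVariationOn.congr h1]
    refine eVariationOn.comp_le_of_monotoneOn _ _ ?_ (fun _ _ => mem_univ _)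
    intro a _ b _ hab
    refine monotone_projIcc _ ?_
    have := Subtype.coe_le_coe.2 hab
    linarith

theorem intrinsicEDist_comm (x y : X) : intrinsicEDist x y = intrinsicEDist y x := by
  have key : ∀ x y : X, intrinsicEDist x y ≤ intrinsicEDist y x := fun x y =>
    le_iInf fun γ => (iInf_le _ γ.symm).trans (pathLength_symm γ).le
  exact le_antisymm (key x y) (key y x)

theorem intrinsicEDist_triangle (x y z : X) :
    intrinsicEDist x z ≤ intrinsicEDist x y + intrinsicEDist y z := by
  refine ENNReal.le_iInf_add_iInf fun γ γ' => ?_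
  exact (iInf_le _ (γ.trans γ')).trans (pathLength_trans_le γ γ')

theorem intrinsicEDist_ne_top [RectifiablyConnected X] (x y : X) : intrinsicEDist x y ≠ ⊤ := by
  obtain ⟨γ, hγ⟩ := RectifiablyConnected.exists_path x y
  exact ne_top_of_le_ne_top hγ (iInf_le _ γ)

end Intrinsic

/-- The set `X`, to be equipped with the intrinsic metric `d_I` in place of its own metric. -/
def Intrinsic (X : Type*) : Type _ := X

theorem Intrinsic.eq_of_intrinsicEDist_eq_zero {X : Type*} [EMetricSpace X] {x y : X}
    (h : intrinsicEDist x y = 0) : x = y :=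
  edist_eq_zero.1 (le_antisymm ((edist_le_intrinsicEDist x y).trans h.le) zero_le)

/-- The intrinsic metric, `d_I(x, y) = intrinsicEDist x y`, as an extended metric. -/
noncomputable abbrev Intrinsic.emetricSpace (X : Type*) [EMetricSpace X] :
    EMetricSpace (Intrinsic X) where
  edist x y := intrinsicEDist (X := X) x y
  edist_self x := intrinsicEDist_self (X := X) x
  edist_comm x y := intrinsicEDist_comm (X := X) x y
  edist_triangle x y z := intrinsicEDist_triangle (X := X) x y z
  eq_of_edist_eq_zero h := Intrinsic.eq_of_intrinsicEDist_eq_zero (X := X) h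

/-- The intrinsic metric, in the case where it is finite. -/
noncomputable instance Intrinsic.metricSpace (X : Type*) [EMetricSpace X]
    [RectifiablyConnected X] : MetricSpace (Intrinsic X) :=
  @EMetricSpace.toMetricSpace (Intrinsic X) (Intrinsic.emetricSpace X)
    fun x y => intrinsicEDist_ne_top (X := X) x y

theorem Intrinsic.edist_eq {X : Type*} [EMetricSpace X] [RectifiablyConnected X] (x y : X) :
    edist (α := Intrinsic X) x y = intrinsicEDist x y := rfl

/-! ### Configuration spaces and the `Y`-graph -/

/-- The space `F(X, 2)` of ordered pairs of distinct points of `X`, with the metric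
`d((a, a'), (b, b')) = √(d(a, b)² + d(a', b')²)`. -/
abbrev Conf2 (X : Type*) [MetricSpace X] : Type _ :=
  {p : WithLp 2 (X × X) // p.fst ≠ p.snd}

/-- The `Y`-graph whose three arms have lengths `ℓ 0`, `ℓ 1`, `ℓ 2`, realised as the union of the
segments `[0, ℓ i] · eᵢ` of the coordinate axes of `ℝ³`; the essential vertex is the origin. The
`ℓ¹`-distance of `ℝ³` restricts to the path distance of the graph: it is `|s - t|` for points at
distances `s`, `t` from the vertex on the same arm, and `s + t` on different arms. -/
abbrev YGraph (ℓ : Fin 3 → ℝ) : Type :=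
  {x : PiLp 1 (fun _ : Fin 3 => ℝ) // ∃ i, ∃ s ∈ Icc 0 (ℓ i), x = PiLp.single 1 i s}

section YGraph

variable {ℓ : Fin 3 → ℝ}

/-- The point at distance `s` from the vertex on the arm `i`. -/
def armPoint (i : Fin 3) (s : Icc 0 (ℓ i)) : YGraph ℓ :=
  ⟨PiLp.single 1 i (s : ℝ), i, s, s.2, rfl⟩

theorem armPoint_apply_self (i : Fin 3) (s : Icc 0 (ℓ i)) : (armPoint i s).1 i = s := by
  simp [armPoint]

theorem armPoint_apply_ne {i j : Fin 3} (h : j ≠ i) (s : Icc 0 (ℓ i)) :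
    (armPoint i s).1 j = 0 := by
  simp [armPoint, h]

theorem dist_armPoint_same (i : Fin 3) (s t : Icc 0 (ℓ i)) :
    dist (armPoint i s) (armPoint i t) = |(s : ℝ) - t| := by
  rw [Subtype.dist_eq, PiLp.dist_eq_of_L1, Finset.sum_eq_single i]
  · rw [armPoint_apply_self, armPoint_apply_self, Real.dist_eq]
  · intro j _ hj
    rw [armPoint_apply_ne hj, armPoint_apply_ne hj, dist_self]
  · simp

theorem dist_armPoint_ne {i j : Fin 3} (h : i ≠ j) (s : Icc 0 (ℓ i)) (t : Icc 0 (ℓ j)) :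
    dist (armPoint i s) (armPoint j t) = (s : ℝ) + t := by
  have hs := s.2.1
  have ht := t.2.1
  rw [Subtype.dist_eq, PiLp.dist_eq_of_L1, Finset.sum_eq_add i j h]
  · rw [armPoint_apply_self, armPoint_apply_self, armPoint_apply_ne h, armPoint_apply_ne h.symm]
    simp [abs_of_nonneg hs, abs_of_nonneg ht]
  · intro k _ hk
    rw [armPoint_apply_ne hk.1, armPoint_apply_ne hk.2, dist_self]
  · simp
  · simp

/-- The configuration `(s · eᵢ, t · eⱼ)`, provided that the two points are distinct. -/
def armConf (i j : Fin 3) (s : Icc 0 (ℓ i)) (t : Icc 0 (ℓ j))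
    (h : armPoint i s ≠ armPoint j t) : Conf2 (YGraph ℓ) :=
  ⟨WithLp.toLp 2 (armPoint i s, armPoint j t), h⟩

theorem exists_armConf (p : Conf2 (YGraph ℓ)) : ∃ i j s t h, p = armConf i j s t h := by
  obtain ⟨⟨⟨⟨x, i, s, hs, rfl⟩, ⟨y, j, t, ht, rfl⟩⟩⟩, h⟩ := p
  exact ⟨i, j, ⟨s, hs⟩, ⟨t, ht⟩, h, rfl⟩

/-- The point of `[0, L]` at parameter `u` on the segment from `s` to `s'`. -/
def segPoint {L : ℝ} (s s' : Icc 0 L) (u : I) : Icc 0 L :=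
  ⟨(1 - u) * s + u * s', by
    have h0 := u.2.1
    have h1 : 0 ≤ 1 - (u : ℝ) := sub_nonneg.2 u.2.2
    constructor
    · exact add_nonneg (mul_nonneg h1 s.2.1) (mul_nonneg h0 s'.2.1)
    · nlinarith [mul_le_mul_of_nonneg_left s.2.2 h1, mul_le_mul_of_nonneg_left s'.2.2 h0]⟩

theorem lipschitzWith_armPoint_segPoint (i : Fin 3) (s s' : Icc 0 (ℓ i)) :
    LipschitzWith (Real.nnabs (s' - s)) (fun u : I => armPoint i (segPoint s s' u)) := by
  refine LipschitzWith.of_dist_le_mul fun u w => ?_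
  rw [dist_armPoint_same, Real.coe_nnabs, Subtype.dist_eq, Real.dist_eq, ← abs_mul]
  refine le_of_eq (congrArg _ ?_)
  simp only [segPoint]
  ring

/-- Two points are joined by a path of finite length. -/
def RectJoined {X : Type*} [PseudoEMetricSpace X] (x y : X) : Prop :=
  ∃ γ : Path x y, pathLength γ ≠ ⊤

theorem RectJoined.symm {X : Type*} [PseudoEMetricSpace X] {x y : X} (h : RectJoined x y) :
    RectJoined y x := by
  obtain ⟨γ, hγ⟩ := h
  exact ⟨γ.symm, by rwa [pathLength_symm]⟩

theorem RectJoined.trans {X : Type*} [PseudoEMetricSpace X] {x y z : X} (h : RectJoined x y)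
    (h' : RectJoined y z) : RectJoined x z := by
  obtain ⟨γ, hγ⟩ := h
  obtain ⟨γ', hγ'⟩ := h'
  exact ⟨γ.trans γ', ne_top_of_le_ne_top (ENNReal.add_ne_top.2 ⟨hγ, hγ'⟩)
    (pathLength_trans_le γ γ')⟩

theorem rectJoined_armConf {i j : Fin 3} {s s' : Icc 0 (ℓ i)} {t t' : Icc 0 (ℓ j)}
    (h : armPoint i s ≠ armPoint j t) (h' : armPoint i s' ≠ armPoint j t')
    (hu : ∀ u, armPoint i (segPoint s s' u) ≠ armPoint j (segPoint t t' u)) :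
    RectJoined (armConf i j s t h) (armConf i j s' t' h') := by
  let f : I → Conf2 (YGraph ℓ) := fun u => armConf i j _ _ (hu u)
  have hf : LipschitzWith _ f := LipschitzWith.subtype_mk
    ((WithLp.prod_lipschitzWith_toLp 2 (YGraph ℓ) (YGraph ℓ)).comp
      ((lipschitzWith_armPoint_segPoint i s s').prodMk (lipschitzWith_armPoint_segPoint j t t')))
    hu
  refine ⟨⟨⟨f, hf.continuous⟩, ?_, ?_⟩, ?_⟩
  · simp [f, segPoint]
  · simp [f, segPoint]
  · have hb : BoundedVariationOn (fun u : I => (u : ℝ)) univ :=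
      (Subtype.mono_coe _).monotoneOn _ |>.boundedVariationOn (C := 1) fun u _ => by
        rw [abs_of_nonneg u.2.1]; exact u.2.2
    have hb' : BoundedVariationOn (id : I → I) univ := hb
    exact hf.comp_boundedVariationOn hb'

theorem armPoint_ne_of_lt {i j : Fin 3} {s : Icc 0 (ℓ i)} {t : Icc 0 (ℓ j)}
    (hs : 0 < (s : ℝ)) (hij : i = j → (t : ℝ) < s) : armPoint i s ≠ armPoint j t := by
  intro h
  have h1 : (armPoint i s).1 i = (armPoint j t).1 i := by rw [h]
  rw [armPoint_apply_self] at h1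
  by_cases e : i = j
  · subst e
    rw [armPoint_apply_self] at h1
    exact (hij rfl).ne h1.symm
  · rw [armPoint_apply_ne e] at h1
    exact hs.ne' h1

variable [hℓ : Fact (∀ i, 0 < ℓ i)]

/-- The vertex, as the point at distance `0` on some arm. -/
def zeroPt (ℓ : Fin 3 → ℝ) [hℓ : Fact (∀ i, 0 < ℓ i)] (i : Fin 3) : Icc 0 (ℓ i) :=
  ⟨0, le_rfl, (hℓ.out i).le⟩

/-- The endpoint of an arm. -/
def endPt (ℓ : Fin 3 → ℝ) [hℓ : Fact (∀ i, 0 < ℓ i)] (i : Fin 3) : Icc 0 (ℓ i) :=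
  ⟨ℓ i, (hℓ.out i).le, le_rfl⟩

theorem armPoint_zeroPt (i j : Fin 3) : armPoint i (zeroPt ℓ i) = armPoint j (zeroPt ℓ j) := by
  apply Subtype.ext
  ext k
  simp [armPoint, zeroPt]

theorem armPoint_endPt_ne (i j : Fin 3) : armPoint i (endPt ℓ i) ≠ armPoint j (zeroPt ℓ j) :=
  armPoint_ne_of_lt (hℓ.out i) fun _ => hℓ.out i

/-- The first point at the end of the arm `i`, the second one at the vertex. -/
def fstNode (ℓ : Fin 3 → ℝ) [Fact (∀ i, 0 < ℓ i)] (i : Fin 3) : Conf2 (YGraph ℓ) :=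
  armConf i i (endPt ℓ i) (zeroPt ℓ i) (armPoint_endPt_ne i i)

/-- The second point at the end of the arm `i`, the first one at the vertex. -/
def sndNode (ℓ : Fin 3 → ℝ) [Fact (∀ i, 0 < ℓ i)] (i : Fin 3) : Conf2 (YGraph ℓ) :=
  armConf i i (zeroPt ℓ i) (endPt ℓ i) (armPoint_endPt_ne i i).symm

theorem segPoint_lt {L M : ℝ} {s s' : Icc 0 L} {t t' : Icc 0 M} (h : (t : ℝ) < s)
    (h' : (t' : ℝ) < s') (u : I) : (segPoint t t' u : ℝ) < segPoint s s' u := by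
  have h0 := u.2.1
  have h1 : 0 ≤ 1 - (u : ℝ) := sub_nonneg.2 u.2.2
  simp only [segPoint]
  rcases h0.eq_or_lt with e | hpos
  · simp [← e, h]
  · nlinarith [mul_le_mul_of_nonneg_left h.le h1, mul_lt_mul_of_pos_left h' hpos]

theorem rectJoined_fstNode {i j : Fin 3} {s : Icc 0 (ℓ i)} {t : Icc 0 (ℓ j)}
    (h : armPoint i s ≠ armPoint j t) (hs : 0 < (s : ℝ)) (hij : i = j → (t : ℝ) < s) :
    RectJoined (armConf i j s t h) (fstNode ℓ i) := by
  have e : fstNode ℓ i = armConf i j (endPt ℓ i) (zeroPt ℓ j) (armPoint_endPt_ne i j) := by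
    simp only [fstNode, armConf, armPoint_zeroPt i j]
  rw [e]
  refine rectJoined_armConf _ _ fun u => armPoint_ne_of_lt ?_ fun hi => ?_
  · have := segPoint_lt (t := zeroPt ℓ i) (t' := zeroPt ℓ i) (s := s) (s' := endPt ℓ i) hs
      (hℓ.out i) u
    simpa [segPoint, zeroPt] using this
  · exact segPoint_lt (hij hi) (hℓ.out i) u

theorem rectJoined_sndNode {i j : Fin 3} {s : Icc 0 (ℓ i)} {t : Icc 0 (ℓ j)}
    (h : armPoint i s ≠ armPoint j t) (ht : 0 < (t : ℝ)) (hij : j = i → (s : ℝ) < t) :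
    RectJoined (armConf i j s t h) (sndNode ℓ j) := by
  have e : sndNode ℓ j = armConf i j (zeroPt ℓ i) (endPt ℓ j) (armPoint_endPt_ne j i).symm := by
    simp only [sndNode, armConf, armPoint_zeroPt j i]
  rw [e]
  refine rectJoined_armConf _ _ fun u => (armPoint_ne_of_lt ?_ fun hi => ?_).symm
  · have := segPoint_lt (t := zeroPt ℓ j) (t' := zeroPt ℓ j) (s := t) (s' := endPt ℓ j) ht
      (hℓ.out j) u
    simpa [segPoint, zeroPt] using this
  · exact segPoint_lt (hij hi) (hℓ.out j) u

theorem rectJoined_fst_snd {i j : Fin 3} (hij : i ≠ j) :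
    RectJoined (fstNode ℓ i) (sndNode ℓ j) := by
  have h : armPoint i (endPt ℓ i) ≠ armPoint j (endPt ℓ j) :=
    armPoint_ne_of_lt (hℓ.out i) fun e => absurd e hij
  exact (rectJoined_fstNode h (hℓ.out i) fun e => absurd e hij).symm.trans
    (rectJoined_sndNode h (hℓ.out j) fun e => absurd e.symm hij)

theorem rectJoined_fst_fst (i j : Fin 3) : RectJoined (fstNode ℓ i) (fstNode ℓ j) := by
  obtain ⟨k, hk, hk'⟩ : ∃ k, i ≠ k ∧ j ≠ k := by decide +revert
  exact (rectJoined_fst_snd hk).trans (rectJoined_fst_snd hk').symm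

theorem rectJoined_base (p : Conf2 (YGraph ℓ)) : RectJoined p (fstNode ℓ 0) := by
  have hsnd : ∀ j, RectJoined (sndNode ℓ j) (fstNode ℓ 0) := fun j => by
    obtain ⟨k, hk⟩ : ∃ k, k ≠ j := by decide +revert
    exact (rectJoined_fst_snd hk).symm.trans (rectJoined_fst_fst k 0)
  obtain ⟨i, j, s, t, h, rfl⟩ := exists_armConf p
  by_cases hij : i = j
  · subst hij
    rcases lt_trichotomy (s : ℝ) t with hlt | heq | hgt
    · exact (rectJoined_sndNode h (s.2.1.trans_lt hlt) fun _ => hlt).trans (hsnd _)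
    · exact absurd (congrArg _ (Subtype.ext heq)) h
    · exact (rectJoined_fstNode h (t.2.1.trans_lt hgt) fun _ => hgt).trans
        (rectJoined_fst_fst _ _)
  · rcases s.2.1.eq_or_lt with hs | hs
    · rcases t.2.1.eq_or_lt with ht | ht
      · have e1 : s = zeroPt ℓ i := Subtype.ext hs.symm
        have e2 : t = zeroPt ℓ j := Subtype.ext ht.symm
        subst e1 e2
        exact absurd (armPoint_zeroPt i j) h
      · exact (rectJoined_sndNode h ht fun e => absurd e.symm hij).trans (hsnd _)
    · exact (rectJoined_fstNode h hs fun e => absurd e hij).trans (rectJoined_fst_fst _ _)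

/-- Any two configurations are joined by a path of finite length, so that the intrinsic metric
on `F(Y, 2)` is finite. -/
instance : RectifiablyConnected (Conf2 (YGraph ℓ)) where
  exists_path x y := (rectJoined_base x).trans (rectJoined_base y).symm

end YGraph

end GeoComp

namespace GeoComp

open Set Filter Topology unitInterval
open scoped ENNReal NNReal

/-! ### Coordinates, distances and geodesics in the `Y`-graph. -/

section Tree
variable {ℓ : Fin 3 → ℝ}

/-! The graph is a tree, so its points are joined by unique geodesics, and a pair `x`, `y` of
configurations falls into one of two classes: moving both points along their geodesics at constant
speed either never makes them collide (`NoCollision x y`) or does.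

Without collision the motion lies in the configuration space, so `d_I(x, y) = d(x, y)` and it is a
geodesic (`dist_toIntrinsic`). With a collision, `d_I(x, y) = |x| + |y|`, where `|x|` (`confRadius`)
is the distance of `x` from the pair `(v, v)`. This length is attained only in the completion, by
running straight into the added cone point `(v, v)` and out again. The upper bound comes from
contraction towards `(v, v)`. The strict lower bound `lt_pathLength` rests on angles at `(v, v)`:
`NoCollision` is transitive between configurations at acute angles (`noCollision_trans`), so a path
between colliding `x` and `y` must first reach a point at a non-acute angle with `x` and then, at
the same time or later, one at a non-acute angle with `y`. These two pieces are longer than `|x|`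
and `|y|`.

The open set of pairs without collision and its closed complement then give `GC ≤ 1`. On the first,
the straight motion is used. On the second, one shrinks `x` to the scale `s`, follows the `s`-scaled
copy of a path of finite length from `x` to `y`, and expands to `y`: as `s → 0` the length tends to
`|x| + |y|`. The paths to be scaled must depend continuously on the pair. They come from the
homotopy equivalence of the configuration space with the plane `ℝ³ / diagonal` minus its origin,
given by the difference of the two points (`confDiff`, with `foldConf` going back): turn the
direction of `x` by a half-turn in a fixed sense, then move along a segment to that of `y`. This
works on the open set `rotSet`, which contains all colliding pairs, so the same two plans also give
`TC ≤ 1`.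

If either invariant were `0`, there would be a global motion plan in the configuration space.
Applied to a loop of winding number one it would produce a continuous logarithm on the circle
(`not_hasMotionPlan_univ`). Finally, the completion is geodesic because it is compact and the
geodesics between configurations pass to limits. -/

theorem coord_nonneg (a : YGraph ℓ) (k : Fin 3) : 0 ≤ a.1 k := by
  obtain ⟨x, i, s, hs, rfl⟩ := a
  by_cases h : k = i
  · subst h; simpa using hs.1
  · simp [h]

theorem exists_arm (a : YGraph ℓ) : ∃ i, ∀ k, k ≠ i → a.1 k = 0 := by
  obtain ⟨x, i, s, hs, rfl⟩ := a
  exact ⟨i, fun k hk => by simp [hk]⟩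

theorem coord_eq_zero {a : YGraph ℓ} {i k : Fin 3} (h : 0 < a.1 i) (hk : k ≠ i) : a.1 k = 0 := by
  obtain ⟨j, hj⟩ := exists_arm a
  by_cases hi : i = j
  · subst hi; exact hj k hk
  · exact absurd (hj i hi) h.ne'

theorem coord_le [hℓ : Fact (∀ i, 0 < ℓ i)] (a : YGraph ℓ) (k : Fin 3) : a.1 k ≤ ℓ k := by
  obtain ⟨x, i, s, hs, rfl⟩ := a
  by_cases h : k = i
  · subst h; simpa using hs.2
  · simpa [h] using (hℓ.out k).le

theorem YGraph.ext_coord {a b : YGraph ℓ} (h : ∀ k, a.1 k = b.1 k) : a = b :=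
  Subtype.ext (PiLp.ext h)

/-- A vector with nonnegative coordinates, all but one of which vanish, is a point of the graph if
its coordinates are bounded by the lengths of the arms. -/
def mkPoint (v : Fin 3 → ℝ) (h0 : ∀ k, 0 ≤ v k) (h1 : ∀ k, v k ≤ ℓ k)
    (h2 : ∃ i, ∀ k, k ≠ i → v k = 0) : YGraph ℓ :=
  ⟨WithLp.toLp 1 v, by
    obtain ⟨i, hi⟩ := h2
    refine ⟨i, v i, ⟨h0 i, h1 i⟩, ?_⟩
    ext k
    by_cases hk : k = i
    · subst hk; simp
    · simp [hk, hi k hk]⟩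

theorem dist_eq_sum (a b : YGraph ℓ) : dist a b = ∑ k, |a.1 k - b.1 k| := by
  rw [Subtype.dist_eq, PiLp.dist_eq_of_L1]; rfl

theorem abs_coord_sub_le (a b : YGraph ℓ) (k : Fin 3) : |a.1 k - b.1 k| ≤ dist a b := by
  rw [dist_eq_sum]
  exact Finset.single_le_sum (f := fun k => |a.1 k - b.1 k|) (fun _ _ => abs_nonneg _)
    (Finset.mem_univ k)

/-- The distance from the vertex. -/
def radius (a : YGraph ℓ) : ℝ := ∑ k, a.1 k

theorem radius_nonneg (a : YGraph ℓ) : 0 ≤ radius a := Finset.sum_nonneg fun k _ => coord_nonneg a k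

theorem coord_le_radius (a : YGraph ℓ) (k : Fin 3) : a.1 k ≤ radius a :=
  Finset.single_le_sum (f := fun k => a.1 k) (fun k _ => coord_nonneg a k) (Finset.mem_univ k)

theorem radius_eq {a : YGraph ℓ} {i : Fin 3} (h : ∀ k, k ≠ i → a.1 k = 0) : radius a = a.1 i :=
  Finset.sum_eq_single i (fun k _ hk => h k hk) (by simp)

theorem radius_eq_of_pos {a : YGraph ℓ} {i : Fin 3} (h : 0 < a.1 i) : radius a = a.1 i :=
  radius_eq fun _ hk => coord_eq_zero h hk

theorem dist_of_pos {a b : YGraph ℓ} {i : Fin 3} (ha : 0 < a.1 i) (hb : 0 < b.1 i) :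
    dist a b = |a.1 i - b.1 i| := by
  rw [dist_eq_sum]
  exact Finset.sum_eq_single i (fun k _ hk => by
    rw [coord_eq_zero ha hk, coord_eq_zero hb hk, sub_zero, abs_zero]) (by simp)

theorem dist_of_disjoint {a b : YGraph ℓ} (h : ∀ k, a.1 k = 0 ∨ b.1 k = 0) :
    dist a b = radius a + radius b := by
  rw [dist_eq_sum, radius, radius, ← Finset.sum_add_distrib]
  refine Finset.sum_congr rfl fun k _ => ?_
  rcases h k with h | h
  · rw [h, zero_sub, abs_neg, zero_add, abs_of_nonneg (coord_nonneg b k)]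
  · rw [h, sub_zero, add_zero, abs_of_nonneg (coord_nonneg a k)]

theorem disjoint_of_pos {a b : YGraph ℓ} {i : Fin 3} (ha : 0 < a.1 i) (hb : b.1 i = 0) (k : Fin 3) :
    a.1 k = 0 ∨ b.1 k = 0 := by
  by_cases hk : k = i
  · subst hk; exact Or.inr hb
  · exact Or.inl (coord_eq_zero ha hk)

theorem eq_of_coord_eq {a b : YGraph ℓ} {i : Fin 3} (ha : 0 < a.1 i) (h : a.1 i = b.1 i) :
    a = b := by
  refine YGraph.ext_coord fun k => ?_
  by_cases hk : k = i
  · subst hk; exact h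
  · rw [coord_eq_zero ha hk, coord_eq_zero (h ▸ ha) hk]

/-- Two points lie on a common arm or on different arms. -/
theorem arm_cases (a b : YGraph ℓ) :
    (∃ i, (∀ k, k ≠ i → a.1 k = 0) ∧ ∀ k, k ≠ i → b.1 k = 0) ∨
    ∃ i j, i ≠ j ∧ (∀ k, k ≠ i → a.1 k = 0) ∧ ∀ k, k ≠ j → b.1 k = 0 := by
  obtain ⟨i, hi⟩ := exists_arm a
  obtain ⟨j, hj⟩ := exists_arm b
  by_cases h : i = j
  · subst h; exact Or.inl ⟨i, hi, hj⟩
  · exact Or.inr ⟨i, j, h, hi, hj⟩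

theorem continuous_coord (k : Fin 3) : Continuous fun a : YGraph ℓ => a.1 k := by fun_prop

theorem continuous_of_coord {X : Type*} [TopologicalSpace X] {f : X → YGraph ℓ}
    (h : ∀ k, Continuous fun x => (f x).1 k) : Continuous f := by
  refine Continuous.subtype_mk (f := fun x => (f x).1) ?_ _
  exact (PiLp.continuous_toLp 1 (fun _ : Fin 3 => ℝ)).comp (continuous_pi h)

/-- The point at parameter `u` on the geodesic from `a` to `b`. -/
noncomputable def geod [hℓ : Fact (∀ i, 0 < ℓ i)] (a b : YGraph ℓ) (u : I) : YGraph ℓ :=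
  -- The point sought has distances `u * dist a b` from `a` and `(1 - u) * dist a b` from `b`. Each
  -- lower bound on the coordinate is attained on the portion of the geodesic that descends from
  -- `a`, respectively ascends to `b`.
  mkPoint (fun k => max (max (a.1 k - u * dist a b) (b.1 k - (1 - u) * dist a b)) 0)
    (fun k => le_max_right _ _)
    (fun k => by
      have h0 := u.2.1
      have h1 := u.2.2
      have hd : 0 ≤ dist a b := dist_nonneg
      refine max_le (max_le ?_ ?_) (hℓ.out k).le
      · nlinarith [coord_le a k]
      · nlinarith [coord_le b k, mul_nonneg (sub_nonneg.2 h1) hd])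
    (by
      have h0 := u.2.1
      have h1 := sub_nonneg.2 u.2.2
      have hd : 0 ≤ dist a b := dist_nonneg
      have hud := mul_nonneg h0 hd
      have hud' := mul_nonneg h1 hd
      obtain ⟨i, hi⟩ := exists_arm a
      obtain ⟨j, hj⟩ := exists_arm b
      by_cases hij : i = j
      · subst hij
        refine ⟨i, fun k hk => ?_⟩
        rw [hi k hk, hj k hk]
        exact max_eq_right (max_le (by linarith) (by linarith))
      · have hdis : dist a b = a.1 i + b.1 j := by
          rw [dist_of_disjoint, radius_eq hi, radius_eq hj]
          intro k
          by_cases hk : k = i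
          · exact Or.inr (hj k (hk ▸ hij))
          · exact Or.inl (hi k hk)
        rcases le_total (a.1 i) (u * dist a b) with h | h
        · refine ⟨j, fun k hk => max_eq_right (max_le ?_ ?_)⟩
          · by_cases hki : k = i
            · subst hki; linarith
            · rw [hi k hki]; linarith
          · rw [hj k hk]; linarith
        · refine ⟨i, fun k hk => max_eq_right (max_le ?_ ?_)⟩
          · rw [hi k hk]; linarith
          · by_cases hkj : k = j
            · subst hkj; linarith
            · rw [hj k hkj]; linarith)

variable [hℓ : Fact (∀ i, 0 < ℓ i)]

theorem geod_coord (a b : YGraph ℓ) (u : I) (k : Fin 3) : (geod a b u).1 k =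
    max (max (a.1 k - u * dist a b) (b.1 k - (1 - u) * dist a b)) 0 := rfl

theorem geod_zero (a b : YGraph ℓ) : geod a b 0 = a := by
  refine YGraph.ext_coord fun k => ?_
  rw [geod_coord]
  have h := (abs_le.1 (abs_coord_sub_le a b k)).1
  rw [max_eq_left (a := a.1 k - _)] <;> simp
  · exact coord_nonneg a k
  · linarith

theorem geod_one (a b : YGraph ℓ) : geod a b 1 = b := by
  refine YGraph.ext_coord fun k => ?_
  rw [geod_coord]
  have h := (abs_le.1 (abs_coord_sub_le a b k)).2
  rw [max_eq_right (b := b.1 k - _)] <;> simp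
  · exact coord_nonneg b k
  · linarith

theorem geod_self (a : YGraph ℓ) (u : I) : geod a a u = a := by
  refine YGraph.ext_coord fun k => ?_
  rw [geod_coord]
  simpa using coord_nonneg a k

theorem continuous_geod : Continuous fun p : (YGraph ℓ × YGraph ℓ) × I => geod p.1.1 p.1.2 p.2 := by
  refine continuous_of_coord fun k => ?_
  simp only [geod_coord]
  have h1 : Continuous fun p : (YGraph ℓ × YGraph ℓ) × I => p.1.1.1 k :=
    (continuous_coord k).comp (by fun_prop)
  have h2 : Continuous fun p : (YGraph ℓ × YGraph ℓ) × I => p.1.2.1 k :=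
    (continuous_coord k).comp (by fun_prop)
  fun_prop

/-- Coordinates are convex along geodesics. -/
theorem geod_coord_le (a b : YGraph ℓ) (u : I) (k : Fin 3) :
    (geod a b u).1 k ≤ (1 - u) * a.1 k + u * b.1 k := by
  have h0 := u.2.1
  have h1 := sub_nonneg.2 u.2.2
  have h := abs_le.1 (abs_coord_sub_le a b k)
  rw [geod_coord]
  refine max_le (max_le ?_ ?_) ?_
  · nlinarith
  · nlinarith
  · exact add_nonneg (mul_nonneg h1 (coord_nonneg a k)) (mul_nonneg h0 (coord_nonneg b k))

/-- Along a geodesic within an arm the coordinate is affine. -/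
theorem geod_coord_of_pos {a b : YGraph ℓ} {i : Fin 3} (ha : 0 < a.1 i) (hb : 0 < b.1 i) (u : I) :
    (geod a b u).1 i = (1 - u) * a.1 i + u * b.1 i := by
  refine le_antisymm (geod_coord_le a b u i) ?_
  rw [geod_coord, dist_of_pos ha hb]
  rcases abs_cases (a.1 i - b.1 i) with ⟨h, _⟩ | ⟨h, _⟩
  · exact le_max_of_le_left (le_max_of_le_left (by rw [h]; linarith))
  · exact le_max_of_le_left (le_max_of_le_right (by rw [h]; linarith))

/-- Two arms together form an interval, whose two halves are the positive and negative parts of a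
real parameter. -/
theorem abs_max_zero_sub_add (p q : ℝ) :
    |max p 0 - max q 0| + |max (-p) 0 - max (-q) 0| = |p - q| := by
  rcases le_total p 0 with hp | hp <;> rcases le_total q 0 with hq | hq <;>
    simp only [max_eq_left, max_eq_right, hp, hq, neg_nonneg, neg_nonpos, sub_zero, zero_sub,
      abs_neg, sub_self, abs_zero, add_zero, zero_add, sub_neg_eq_add]
  · rw [neg_add_eq_sub, abs_sub_comm]
  · rw [abs_of_nonneg hq, abs_of_nonpos hp, abs_of_nonpos (by linarith)]; ring
  · rw [abs_of_nonneg hp, abs_of_nonpos hq, abs_of_nonneg (by linarith)]; ring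

theorem geod_coord_eq_zero {a b : YGraph ℓ} {k : Fin 3} (ha : a.1 k = 0) (hb : b.1 k = 0) (u : I) :
    (geod a b u).1 k = 0 :=
  le_antisymm ((geod_coord_le a b u k).trans (by simp [ha, hb])) (coord_nonneg _ k)

theorem dist_geod_le (a b : YGraph ℓ) (u w : I) :
    dist (geod a b u) (geod a b w) ≤ |(u : ℝ) - w| * dist a b := by
  have hd : 0 ≤ dist a b := dist_nonneg
  have e1 : ∀ s : ℝ, |s - u * dist a b - (s - w * dist a b)| = |(u : ℝ) - w| * dist a b := by
    intro s
    rw [← abs_of_nonneg hd, ← abs_mul, ← abs_neg, abs_of_nonneg hd]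
    congr 1
    ring
  have e2 : ∀ s : ℝ, |s - (1 - u) * dist a b - (s - (1 - w) * dist a b)|
      = |(u : ℝ) - w| * dist a b := by
    intro s
    rw [← abs_of_nonneg hd, ← abs_mul, abs_of_nonneg hd]
    congr 1
    ring
  rcases arm_cases a b with ⟨i, hi, hj⟩ | ⟨i, j, hij, hi, hj⟩
  · rw [dist_eq_sum, Finset.sum_eq_single i]
    · rw [geod_coord, geod_coord]
      refine (abs_max_sub_max_le_abs _ _ _).trans ((abs_max_sub_max_le_max _ _ _ _).trans ?_)
      rw [e1, e2, max_self]
    · intro k _ hk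
      rw [geod_coord_eq_zero (hi k hk) (hj k hk), geod_coord_eq_zero (hi k hk) (hj k hk), sub_zero,
        abs_zero]
    · simp
  · have hai : a.1 j = 0 := hi j hij.symm
    have hbj : b.1 i = 0 := hj i hij
    have hdis : dist a b = a.1 i + b.1 j := by
      rw [dist_of_disjoint, radius_eq hi, radius_eq hj]
      intro k
      by_cases hk : k = i
      · exact Or.inr (hj k (hk ▸ hij))
      · exact Or.inl (hi k hk)
    have hgi : ∀ u : I, (geod a b u).1 i = max (a.1 i - u * dist a b) 0 := fun u => by
      rw [geod_coord, hbj, max_assoc, max_eq_right (a := 0 - _)]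
      linarith [mul_nonneg (sub_nonneg.2 u.2.2) hd]
    have hgj : ∀ u : I, (geod a b u).1 j = max (-(a.1 i - u * dist a b)) 0 := fun u => by
      rw [geod_coord, hai, max_assoc, max_eq_right]
      · congr 1; rw [hdis]; ring
      · exact (by linarith [mul_nonneg u.2.1 hd] : _ ≤ (0 : ℝ)).trans (le_max_right _ _)
    rw [dist_eq_sum, Finset.sum_eq_add i j hij, hgi, hgi, hgj, hgj, abs_max_zero_sub_add, e1]
    · intro k _ hk
      rw [geod_coord_eq_zero (hi k hk.1) (hj k hk.2), geod_coord_eq_zero (hi k hk.1) (hj k hk.2),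
        sub_zero, abs_zero]
    · simp
    · simp
end Tree

/-! ### Angles at the pair of vertices, and collisions of geodesic motions. -/

section Collision
variable {ℓ : Fin 3 → ℝ}

theorem conf_dist_sq (x y : Conf2 (YGraph ℓ)) :
    dist x y ^ 2 = dist x.1.fst y.1.fst ^ 2 + dist x.1.snd y.1.snd ^ 2 := by
  have h : dist x y = (dist x.1.fst y.1.fst ^ (2 : ℝ≥0∞).toReal +
      dist x.1.snd y.1.snd ^ (2 : ℝ≥0∞).toReal) ^ (1 / (2 : ℝ≥0∞).toReal) :=
    WithLp.prod_dist_eq_add (p := 2) (by norm_num) x.1 y.1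
  have h2 : (2 : ℝ≥0∞).toReal = 2 := rfl
  rw [h, h2, ← Real.sqrt_eq_rpow, Real.sq_sqrt]
  · norm_cast
  · positivity

/-- The distance from the pair consisting of the vertex twice. -/
noncomputable def confRadius (x : Conf2 (YGraph ℓ)) : ℝ :=
  √(radius x.1.fst ^ 2 + radius x.1.snd ^ 2)

theorem confRadius_nonneg (x : Conf2 (YGraph ℓ)) : 0 ≤ confRadius x := Real.sqrt_nonneg _

theorem confRadius_sq (x : Conf2 (YGraph ℓ)) :
    confRadius x ^ 2 = radius x.1.fst ^ 2 + radius x.1.snd ^ 2 := Real.sq_sqrt (by positivity)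

theorem coord_eq_zero_of_radius {a : YGraph ℓ} (h : radius a = 0) (k : Fin 3) : a.1 k = 0 :=
  le_antisymm ((coord_le_radius a k).trans h.le) (coord_nonneg a k)

theorem confRadius_pos (x : Conf2 (YGraph ℓ)) : 0 < confRadius x := by
  refine Real.sqrt_pos.2 (lt_of_le_of_ne (by positivity) fun h => x.2 ?_)
  have h1 : radius x.1.fst = 0 := by nlinarith [radius_nonneg x.1.fst, sq_nonneg (radius x.1.snd)]
  have h2 : radius x.1.snd = 0 := by nlinarith [radius_nonneg x.1.fst, sq_nonneg (radius x.1.snd)]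
  exact YGraph.ext_coord fun k => by
    rw [coord_eq_zero_of_radius h1, coord_eq_zero_of_radius h2]

theorem radius_sub_le (a b : YGraph ℓ) : |radius a - radius b| ≤ dist a b := by
  rw [dist_eq_sum, radius, radius, ← Finset.sum_sub_distrib]
  exact Finset.abs_sum_le_sum_abs _ _

/-- The triangle inequality with the pair `(v, v)`, which is not itself a configuration. It reduces
to the Cauchy–Schwarz inequality for the vectors of radii. -/
theorem confRadius_sub_le (x y : Conf2 (YGraph ℓ)) : confRadius x - confRadius y ≤ dist x y := by
  have h1 := radius_sub_le x.1.fst y.1.fst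
  have h2 := radius_sub_le x.1.snd y.1.snd
  have hd : 0 ≤ dist x y := dist_nonneg
  have hs := conf_dist_sq x y
  have hx := confRadius_sq x
  have hy := confRadius_sq y
  have ha := confRadius_nonneg x
  have hb := confRadius_nonneg y
  have h3 : (radius x.1.fst - radius y.1.fst) ^ 2 ≤ dist x.1.fst y.1.fst ^ 2 :=
    sq_le_sq.2 (h1.trans (le_abs_self _))
  have h4 : (radius x.1.snd - radius y.1.snd) ^ 2 ≤ dist x.1.snd y.1.snd ^ 2 :=
    sq_le_sq.2 (h2.trans (le_abs_self _))
  refine abs_le_of_sq_le_sq' (a := confRadius x - confRadius y) ?_ hd |>.2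
  have h5 : radius x.1.fst * radius y.1.fst + radius x.1.snd * radius y.1.snd
      ≤ confRadius x * confRadius y := by
    refine abs_le_of_sq_le_sq' ?_ (mul_nonneg ha hb) |>.2
    rw [mul_pow, hx, hy]
    nlinarith [sq_nonneg (radius x.1.fst * radius y.1.snd - radius x.1.snd * radius y.1.fst)]
  nlinarith

theorem continuous_fst_coord (k : Fin 3) :
    Continuous fun x : Conf2 (YGraph ℓ) => x.1.fst.1 k :=
  (continuous_coord k).comp ((WithLp.continuous_fst 2 _ _).comp continuous_subtype_val)

theorem continuous_snd_coord (k : Fin 3) :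
    Continuous fun x : Conf2 (YGraph ℓ) => x.1.snd.1 k :=
  (continuous_coord k).comp ((WithLp.continuous_snd 2 _ _).comp continuous_subtype_val)

/-- Interchange of the two points of a configuration. -/
def Conf2.swap (x : Conf2 (YGraph ℓ)) : Conf2 (YGraph ℓ) :=
  ⟨WithLp.toLp 2 (x.1.snd, x.1.fst), x.2.symm⟩

@[simp] theorem swap_fst (x : Conf2 (YGraph ℓ)) : x.swap.1.fst = x.1.snd := rfl

@[simp] theorem swap_snd (x : Conf2 (YGraph ℓ)) : x.swap.1.snd = x.1.fst := rfl

theorem fst_coord_ne (x : Conf2 (YGraph ℓ)) {i : Fin 3} (h : 0 < x.1.fst.1 i) :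
    x.1.fst.1 i ≠ x.1.snd.1 i := fun e => x.2 (eq_of_coord_eq h e)

/-- The cosine term in the law of cosines, for the angle at the pair of vertices. -/
noncomputable def cosTerm (x y : Conf2 (YGraph ℓ)) : ℝ :=
  (confRadius x ^ 2 + confRadius y ^ 2 - dist x y ^ 2) / 2

theorem cosTerm_comm (x y : Conf2 (YGraph ℓ)) : cosTerm x y = cosTerm y x := by
  rw [cosTerm, cosTerm, dist_comm]; ring

theorem cosTerm_swap (x y : Conf2 (YGraph ℓ)) : cosTerm x.swap y.swap = cosTerm x y := by
  simp only [cosTerm, conf_dist_sq, confRadius_sq, swap_fst, swap_snd]; ring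

/-- Two configurations have first points in the interior of the same arm. -/
def SameArm (i : Fin 3) (x y : Conf2 (YGraph ℓ)) : Prop := 0 < x.1.fst.1 i ∧ 0 < y.1.fst.1 i

/-- If neither the first nor the second points share an open arm, both distances are sums of radii,
so `dist x y ^ 2` is at least the sum of the squared radii and the angle is not acute. -/
theorem exists_sameArm {x y : Conf2 (YGraph ℓ)} (h : 0 < cosTerm x y) :
    ∃ i, SameArm i x y ∨ SameArm i x.swap y.swap := by
  by_contra! hcon
  have h1 : ∀ k, x.1.fst.1 k = 0 ∨ y.1.fst.1 k = 0 := fun k => by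
    by_contra! h
    exact (hcon k).1 ⟨lt_of_le_of_ne (coord_nonneg _ k) h.1.symm,
      lt_of_le_of_ne (coord_nonneg _ k) h.2.symm⟩
  have h2 : ∀ k, x.1.snd.1 k = 0 ∨ y.1.snd.1 k = 0 := fun k => by
    by_contra! h
    exact (hcon k).2 ⟨lt_of_le_of_ne (coord_nonneg _ k) h.1.symm,
      lt_of_le_of_ne (coord_nonneg _ k) h.2.symm⟩
  rw [cosTerm, conf_dist_sq, dist_of_disjoint h1, dist_of_disjoint h2, confRadius_sq,
    confRadius_sq] at h
  nlinarith [mul_nonneg (radius_nonneg x.1.fst) (radius_nonneg y.1.fst),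
    mul_nonneg (radius_nonneg x.1.snd) (radius_nonneg y.1.snd)]

/-- If the first points are on the same arm, and the second ones on different arms. -/
theorem cosTerm_eq {x y : Conf2 (YGraph ℓ)} {i j : Fin 3} (h : SameArm i x y)
    (hj : x.1.snd.1 j = 0) (hj' : 0 < y.1.snd.1 j) :
    cosTerm x y = x.1.fst.1 i * y.1.fst.1 i - radius x.1.snd * y.1.snd.1 j := by
  rw [cosTerm, conf_dist_sq, dist_of_pos h.1 h.2, dist_comm x.1.snd,
    dist_of_disjoint (disjoint_of_pos hj' hj), confRadius_sq,
    confRadius_sq, radius_eq_of_pos h.1, radius_eq_of_pos h.2, radius_eq_of_pos hj', sq_abs]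
  ring

theorem continuous_cosTerm (x : Conf2 (YGraph ℓ)) : Continuous fun y => cosTerm x y := by
  have : Continuous fun y : Conf2 (YGraph ℓ) => confRadius y := by
    unfold confRadius radius
    exact Real.continuous_sqrt.comp
      (((continuous_finsetSum _ fun k _ => continuous_fst_coord k).pow 2).add
        ((continuous_finsetSum _ fun k _ => continuous_snd_coord k).pow 2))
  unfold cosTerm
  fun_prop

variable [hℓ : Fact (∀ i, 0 < ℓ i)]

/-- The two points of a configuration can be moved along geodesics at constant speed without
colliding. -/
def NoCollision (x y : Conf2 (YGraph ℓ)) : Prop :=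
  ∀ u : I, geod x.1.fst y.1.fst u ≠ geod x.1.snd y.1.snd u

theorem noCollision_swap {x y : Conf2 (YGraph ℓ)} :
    NoCollision x.swap y.swap ↔ NoCollision x y := forall_congr' fun _ => ne_comm

theorem noCollision_self (x : Conf2 (YGraph ℓ)) : NoCollision x x := fun u => by
  rw [geod_self, geod_self]; exact x.2

/-- The first point stays inside the arm `i`, where its coordinate is affine in time. The coordinate
of the second point is convex and starts and ends strictly below, so it stays strictly below. -/
theorem noCollision_of_pos {x y : Conf2 (YGraph ℓ)} {i : Fin 3}
    (h : x.1.snd.1 i < x.1.fst.1 i) (h' : y.1.snd.1 i < y.1.fst.1 i) : NoCollision x y := by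
  intro u e
  have h0 := u.2.1
  have h1 := sub_nonneg.2 u.2.2
  have hx := (coord_nonneg x.1.snd i).trans_lt h
  have hy := (coord_nonneg y.1.snd i).trans_lt h'
  have e1 : (geod x.1.fst y.1.fst u).1 i = (geod x.1.snd y.1.snd u).1 i := by rw [e]
  have e2 := geod_coord_le x.1.snd y.1.snd u i
  rw [← e1, geod_coord_of_pos hx hy] at e2
  rcases h0.eq_or_lt with h | h
  · rw [← h] at e2; linarith
  · nlinarith

/-- If both initial and final first points lie on the interior of the same arm, then a collision
is avoided precisely if the order on that arm is preserved. -/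
theorem noCollision_iff {x y : Conf2 (YGraph ℓ)} {i : Fin 3}
    (hx : 0 < x.1.fst.1 i) (hy : 0 < y.1.fst.1 i) : NoCollision x y ↔
      (x.1.snd.1 i < x.1.fst.1 i ↔ y.1.snd.1 i < y.1.fst.1 i) := by
  have nx := fst_coord_ne x hx
  have ny := fst_coord_ne y hy
  constructor
  -- If the order is reversed, the difference of the `i`-th coordinates changes sign and vanishes at
  -- some time. The first point is then still in the open arm, so equal coordinates mean equal
  -- points.
  · intro hnc
    by_contra hcon
    have hg : ∀ a b : YGraph ℓ, Continuous fun u : I => (geod a b u).1 i := fun a b =>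
      (continuous_coord i).comp (continuous_geod.comp (Continuous.prodMk_right (a, b)))
    have hcont : Continuous fun u : I =>
        (geod x.1.fst y.1.fst u).1 i - (geod x.1.snd y.1.snd u).1 i := (hg _ _).sub (hg _ _)
    have hzero : (0 : ℝ) ∈ range fun u : I =>
        (geod x.1.fst y.1.fst u).1 i - (geod x.1.snd y.1.snd u).1 i := by
      by_cases h : x.1.snd.1 i < x.1.fst.1 i
      · have h' : y.1.fst.1 i < y.1.snd.1 i := by
          rcases lt_or_gt_of_ne ny with h2 | h2
          · exact h2
          · exact absurd (iff_of_true h h2) hcon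
        refine mem_range_of_exists_le_of_exists_ge hcont ⟨1, ?_⟩ ⟨0, ?_⟩
        · simp only [geod_one]; linarith
        · simp only [geod_zero]; linarith
      · have h' : y.1.snd.1 i < y.1.fst.1 i := by
          by_contra h2
          exact hcon (iff_of_false h h2)
        refine mem_range_of_exists_le_of_exists_ge hcont ⟨0, ?_⟩ ⟨1, ?_⟩
        · simp only [geod_zero]; linarith
        · simp only [geod_one]; linarith
    obtain ⟨u, hu⟩ := hzero
    refine hnc u (eq_of_coord_eq (i := i) ?_ (sub_eq_zero.1 hu))
    have h0 := u.2.1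
    have h1 := sub_nonneg.2 u.2.2
    rw [geod_coord_of_pos hx hy]
    rcases h0.eq_or_lt with h | h
    · rw [← h]; linarith
    · exact add_pos_of_nonneg_of_pos (mul_nonneg h1 hx.le) (mul_pos h hy)
  · intro h
    by_cases h1 : x.1.snd.1 i < x.1.fst.1 i
    · exact noCollision_of_pos h1 (h.1 h1)
    · have h2 := fun h2 => h1 (h.2 h2)
      exact noCollision_swap.1 (noCollision_of_pos (x := x.swap) (y := y.swap) (i := i)
        (lt_of_le_of_ne (not_lt.1 h1) nx) (lt_of_le_of_ne (not_lt.1 h2) ny))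

end Collision

/-! ### Transitivity of `NoCollision` at acute angles. -/

section LowerBound
variable {ℓ : Fin 3 → ℝ}

theorem continuous_swap : Continuous (Conf2.swap : Conf2 (YGraph ℓ) → _) :=
  Continuous.subtype_mk ((WithLp.prod_continuous_toLp 2 _ _).comp
    (((WithLp.continuous_snd 2 _ _).comp continuous_subtype_val).prodMk
      ((WithLp.continuous_fst 2 _ _).comp continuous_subtype_val))) _

variable [hℓ : Fact (∀ i, 0 < ℓ i)]

/-- By `noCollision_iff` the question is decided by strict inequalities between coordinates, and
these persist nearby. -/
theorem SameArm.eventually_noCollision_iff {γ : I → Conf2 (YGraph ℓ)} (hγ : Continuous γ)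
    {x : Conf2 (YGraph ℓ)} {u : I} {i : Fin 3} (h : SameArm i x (γ u)) :
    ∀ᶠ w in 𝓝 u, NoCollision x (γ w) ↔ NoCollision x (γ u) := by
  have c1 : Continuous fun w => (γ w).1.fst.1 i := (continuous_fst_coord i).comp hγ
  have c2 : Continuous fun w => (γ w).1.snd.1 i := (continuous_snd_coord i).comp hγ
  have e1 : ∀ᶠ w in 𝓝 u, 0 < (γ w).1.fst.1 i := c1.continuousAt.eventually_const_lt h.2
  rcases lt_or_gt_of_ne (fst_coord_ne _ h.2) with hlt | hlt
  · filter_upwards [e1, c1.continuousAt.eventually_lt c2.continuousAt hlt] with w h1 h2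
    rw [noCollision_iff h.1 h1, noCollision_iff h.1 h.2, iff_false_intro hlt.not_gt,
      iff_false_intro h2.not_gt]
  · filter_upwards [e1, c2.continuousAt.eventually_lt c1.continuousAt hlt] with w h1 h2
    rw [noCollision_iff h.1 h1, noCollision_iff h.1 h.2, iff_true_intro hlt,
      iff_true_intro h2]

/-- Along a path on which the angle with `x` remains acute, no collision with `x` can appear. -/
theorem noCollision_of_path {γ : I → Conf2 (YGraph ℓ)} (hγ : Continuous γ)
    (h : ∀ u, 0 < cosTerm (γ 0) (γ u)) : NoCollision (γ 0) (γ 1) := by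
  have hl : IsLocallyConstant fun u => NoCollision (γ 0) (γ u) := by
    rw [IsLocallyConstant.iff_eventually_eq]
    intro u
    obtain ⟨i, hi | hi⟩ := exists_sameArm (h u)
    · exact (SameArm.eventually_noCollision_iff hγ hi).mono fun w hw => propext hw
    · have := SameArm.eventually_noCollision_iff (γ := fun u => (γ u).swap) (continuous_swap.comp hγ) hi
      simp only [noCollision_swap] at this
      exact this.mono fun w hw => propext hw
  exact cast (hl.apply_eq_of_preconnectedSpace 0 1) (noCollision_self _)

/-- The numerical core of `noCollision_mixed`. -/
theorem collision_inequality {s α t β b p q : ℝ} (hq : 0 ≤ q) (hpq : p + q = 1)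
    (hβ : 0 ≤ β) (h : α * β < s * t)
    (hb : b < s) (hb' : b = 0 ∨ b = β)
    (h1 : s - q * (s + α) ≤ b - q * (β + t)) (h2 : 0 ≤ b - q * (β + t)) (ht : 0 < t) : False := by
  have hq0 : 0 < q := by
    rcases hq.eq_or_lt with h0 | h0
    · rw [← h0] at h1; linarith
    · exact h0
  have hp' : p = 1 - q := by linarith
  rcases hb' with rfl | rfl
  · nlinarith
  · have h3 : p * s ≤ q * α + p * b - q * t := by rw [hp']; linarith
    have h4 : q * t ≤ p * b := by rw [hp']; linarith
    -- Here `b = β`. Multiplying `h3` by `b` and inserting `α * b < s * t` gives `p * s * b < q * t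
    -- * (s - b) + p * b ^ 2`, while `h4` times `s - b` bounds the right-hand side by `p * s * b`.
    nlinarith [mul_le_mul_of_nonneg_right h3 hβ, mul_lt_mul_of_pos_left h hq0,
      mul_le_mul_of_nonneg_right h4 (sub_nonneg.2 hb.le)]

/-- The first point leaves the arm `i` while the second enters the arm `j`. The product inequality
`h` says that the second point passes the vertex before the first one reaches it. -/
theorem noCollision_mixed {x y : Conf2 (YGraph ℓ)} {i j : Fin 3} (hij : i ≠ j)
    (hx : 0 < x.1.fst.1 i) (hx' : x.1.snd.1 i < x.1.fst.1 i) (hxj : x.1.snd.1 j = 0)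
    (hy : 0 < y.1.snd.1 j) (hy' : y.1.fst.1 j < y.1.snd.1 j) (hyi : y.1.fst.1 i = 0)
    (h : radius y.1.fst * radius x.1.snd < x.1.fst.1 i * y.1.snd.1 j) : NoCollision x y := by
  intro u e
  have hu0 := u.2.1
  have hu1 := sub_nonneg.2 u.2.2
  have da : dist x.1.fst y.1.fst = x.1.fst.1 i + radius y.1.fst := by
    rw [dist_of_disjoint (disjoint_of_pos hx hyi), radius_eq_of_pos hx]
  have db : dist x.1.snd y.1.snd = radius x.1.snd + y.1.snd.1 j := by
    rw [dist_comm, dist_of_disjoint (disjoint_of_pos hy hxj), radius_eq_of_pos hy, add_comm]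
  have rad_cases : ∀ (a : YGraph ℓ) k, a.1 k = 0 ∨ a.1 k = radius a := fun a k => by
    rcases (coord_nonneg a k).eq_or_lt with h | h
    · exact Or.inl h.symm
    · exact Or.inr (radius_eq_of_pos h).symm
  have ha := radius_nonneg y.1.fst
  have hb := radius_nonneg x.1.snd
  have ei : (geod x.1.fst y.1.fst u).1 i = (geod x.1.snd y.1.snd u).1 i := by rw [e]
  have ej : (geod x.1.fst y.1.fst u).1 j = (geod x.1.snd y.1.snd u).1 j := by rw [e]
  have hyi' : y.1.snd.1 i = 0 := coord_eq_zero hy hij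
  have hxj' : x.1.fst.1 j = 0 := coord_eq_zero hx hij.symm
  rw [geod_coord, geod_coord, da, db, hyi, hyi'] at ei
  rw [geod_coord, geod_coord, da, db, hxj, hxj'] at ej
  have i1 : x.1.fst.1 i - u * (x.1.fst.1 i + radius y.1.fst) ≤
      max (x.1.snd.1 i - u * (radius x.1.snd + y.1.snd.1 j)) 0 := by
    refine ((le_max_left _ _).trans (le_max_left _ _)).trans (ei.le.trans ?_)
    refine max_le (max_le (le_max_left _ _) (le_max_of_le_right ?_)) (le_max_right _ _)
    nlinarith
  have j1 : y.1.snd.1 j - (1 - u) * (radius x.1.snd + y.1.snd.1 j) ≤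
      max (y.1.fst.1 j - (1 - u) * (x.1.fst.1 i + radius y.1.fst)) 0 := by
    refine ((le_max_right _ _).trans (le_max_left _ _)).trans (ej.symm.le.trans ?_)
    refine max_le (max_le (le_max_of_le_right ?_) (le_max_left _ _)) (le_max_right _ _)
    nlinarith
  -- A collision inside the arm `i` is excluded by `collision_inequality`, so at the time `u` of the
  -- collision the first point has reached the vertex. By the same argument with time reversed, `j2`
  -- says that the second point has not yet gone beyond it into the arm `j`. The product of these
  -- two conditions contradicts `h`.
  have i2 : x.1.fst.1 i - u * (x.1.fst.1 i + radius y.1.fst) ≤ 0 := by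
    by_contra! hcon
    rcases le_max_iff.1 i1 with h3 | h3
    · exact collision_inequality (p := 1 - u) (α := radius y.1.fst) hu0 (by ring) hb h hx' (rad_cases _ _) h3
        (hcon.le.trans h3) hy
    · exact absurd h3 hcon.not_ge
  have j2 : y.1.snd.1 j - (1 - u) * (radius x.1.snd + y.1.snd.1 j) ≤ 0 := by
    by_contra! hcon
    rcases le_max_iff.1 j1 with h3 | h3
    · exact collision_inequality (p := u) (α := radius x.1.snd) hu1 (by ring) ha (by linarith) hy' (rad_cases _ _)
        (by rw [add_comm (y.1.snd.1 j), add_comm (radius y.1.fst)]; exact h3)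
        (by rw [add_comm (radius y.1.fst)]; exact hcon.le.trans h3) hx
    · exact absurd h3 hcon.not_ge
  have k1 : 0 < (u : ℝ) := by
    rcases hu0.eq_or_lt with h0 | h0
    · rw [← h0] at i2; linarith
    · exact h0
  have k2 : 0 < 1 - (u : ℝ) := by
    rcases hu1.eq_or_lt with h0 | h0
    · rw [← h0] at j2; linarith
    · exact h0
  have l1 : (1 - u) * x.1.fst.1 i ≤ u * radius y.1.fst := by linarith
  have l2 : u * y.1.snd.1 j ≤ (1 - u) * radius x.1.snd := by linarith
  have := mul_le_mul l1 l2 (by positivity) (by positivity)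
  nlinarith [mul_pos k1 k2]

theorem noCollision_trans_same {x z y : Conf2 (YGraph ℓ)} {i : Fin 3} (h1 : SameArm i x z)
    (h2 : SameArm i z y) (n1 : NoCollision x z) (n2 : NoCollision z y) : NoCollision x y :=
  (noCollision_iff h1.1 h2.2).2 (((noCollision_iff h1.1 h1.2).1 n1).trans
    ((noCollision_iff h2.1 h2.2).1 n2))

/-- The only new case is that `x` has no second point on the arm `j` and `y` no first point on the
arm `i`. The two acute angles are then inequalities between products of radii, and multiplying them
and cancelling the coordinates of `z` gives the hypothesis of `noCollision_mixed`. -/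
theorem noCollision_trans_mixed {x z y : Conf2 (YGraph ℓ)} {i j : Fin 3} (h1 : SameArm i x z)
    (h2 : SameArm j z.swap y.swap) (q1 : 0 < cosTerm x z) (q2 : 0 < cosTerm z y)
    (n1 : NoCollision x z) (n2 : NoCollision z y) : NoCollision x y := by
  rcases (coord_nonneg x.1.snd j).eq_or_lt with hxj | hxj
  swap
  · exact noCollision_swap.1 (noCollision_trans_same (x := x.swap) ⟨hxj, h2.1⟩ h2
      (noCollision_swap.2 n1) (noCollision_swap.2 n2))
  rcases (coord_nonneg y.1.fst i).eq_or_lt with hyi | hyi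
  swap
  · exact noCollision_trans_same h1 ⟨h1.2, hyi⟩ n1 n2
  have s1 := (noCollision_iff h1.1 h1.2).1 n1
  have s2 := (noCollision_iff h2.1 h2.2).1 (noCollision_swap.2 n2)
  simp only [swap_fst, swap_snd] at s2
  have hz1 : 0 < z.1.fst.1 i := h1.2
  have hz2 : 0 < z.1.snd.1 j := h2.1
  have hx1 : 0 < x.1.fst.1 i := h1.1
  have hy1 : 0 < y.1.snd.1 j := h2.2
  -- On a common arm, `x` would force the first point of `z` to be the outer one, and `y` the
  -- second.
  have hij : i ≠ j := by
    rintro rfl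
    have a1 := s1.1 (by rw [← hxj]; exact hx1)
    have a2 := s2.2 (by rw [← hyi]; exact hy1)
    exact lt_asymm a1 a2
  refine noCollision_mixed hij h1.1 (s1.2 ?_) hxj.symm h2.2 (s2.1 ?_) hyi.symm ?_
  · rw [coord_eq_zero hz2 hij]; exact hz1
  · rw [coord_eq_zero hz1 hij.symm]; exact hz2
  · rw [cosTerm_eq h1 hxj.symm h2.1] at q1
    rw [← cosTerm_swap, cosTerm_comm, cosTerm_eq (i := j) (j := i) ⟨h2.2, h2.1⟩ hyi.symm h1.2] at q2
    simp only [swap_fst, swap_snd] at q2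
    have := mul_lt_mul'' (sub_pos.1 q1) (sub_pos.1 q2)
      (mul_nonneg (radius_nonneg _) hz2.le) (mul_nonneg (radius_nonneg _) hz1.le)
    have hzz := mul_pos hz1 hz2
    refine lt_of_mul_lt_mul_right ?_ hzz.le
    linarith

/-- If the angles of `x` and `y` with `z` are acute and there are no collisions with `z`, then
there is none between `x` and `y`. -/
theorem noCollision_trans {x z y : Conf2 (YGraph ℓ)} (q1 : 0 < cosTerm x z) (q2 : 0 < cosTerm z y)
    (n1 : NoCollision x z) (n2 : NoCollision z y) : NoCollision x y := by
  obtain ⟨i, hi⟩ := exists_sameArm q1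
  obtain ⟨j, hj⟩ := exists_sameArm q2
  have m1 := noCollision_swap.2 n1
  have m2 := noCollision_swap.2 n2
  have p1 : 0 < cosTerm x.swap z.swap := by rwa [cosTerm_swap]
  have p2 : 0 < cosTerm z.swap y.swap := by rwa [cosTerm_swap]
  have same : ∀ {x z y : Conf2 (YGraph ℓ)} {i j}, SameArm i x z → SameArm j z y →
      NoCollision x z → NoCollision z y → NoCollision x y := fun {x z y i j} h1 h2 n1 n2 => by
    have : i = j := by
      by_contra h
      exact absurd h2.1 (coord_eq_zero h1.2 (Ne.symm h)).not_gt
    subst this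
    exact noCollision_trans_same h1 h2 n1 n2
  rcases hi with hi | hi <;> rcases hj with hj | hj
  · exact same hi hj n1 n2
  · exact noCollision_trans_mixed hi hj q1 q2 n1 n2
  · exact noCollision_swap.1 (noCollision_trans_mixed hi hj p1 p2 m1 m2)
  · exact noCollision_swap.1 (same hi hj m1 m2)

end LowerBound

/-! ### Lengths of Lipschitz paths and the intrinsic metric. -/

section Lipschitz

theorem eVariationOn_id_le : eVariationOn (id : I → I) univ ≤ 1 := by
  have hm : MonotoneOn (fun t : I => (t : ℝ)) univ := fun _ _ _ _ h => h
  have h := hm.eVariationOn_eq (mem_univ (0 : I)) (mem_univ (1 : I))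
  have e : (univ ∩ Icc 0 1 : Set I) = univ := by
    rw [univ_inter]; exact eq_univ_of_forall fun t => ⟨t.2.1, t.2.2⟩
  rw [e] at h
  refine le_trans (le_of_eq rfl) (h.le.trans ?_)
  simp

theorem pathLength_le_of_lipschitz {X : Type*} [PseudoEMetricSpace X] {γ : I → X} {K : ℝ≥0}
    (h : LipschitzWith K γ) : pathLength γ ≤ K := by
  have := h.lipschitzOnWith (s := univ) |>.comp_eVariationOn_le (g := (id : I → I)) (s := univ)
    (mapsTo_univ _ _)
  exact this.trans ((mul_le_mul_right eVariationOn_id_le _).trans (mul_one _).le)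

theorem edist_le_pathLength {X : Type*} [PseudoEMetricSpace X] (γ : I → X) :
    edist (γ 0) (γ 1) ≤ pathLength γ := eVariationOn.edist_le γ (mem_univ _) (mem_univ _)

theorem lipschitzWith_segPoint (u w : I) :
    LipschitzWith (Real.nnabs ((w : ℝ) - u)) (fun t : I => (segPoint u w t : I)) := by
  refine LipschitzWith.of_dist_le_mul fun s t => le_of_eq ?_
  rw [Subtype.dist_eq, Subtype.dist_eq, Real.dist_eq, Real.dist_eq, Real.coe_nnabs, ← abs_mul]
  simp only [segPoint]
  congr 1
  ring

/-- A point of `X`, as a point of the space with the intrinsic metric. -/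
def toIntrinsic {X : Type*} (x : X) : Intrinsic X := x

theorem edist_toIntrinsic {X : Type*} [EMetricSpace X] [RectifiablyConnected X] (x y : X) :
    edist (toIntrinsic x) (toIntrinsic y) = intrinsicEDist x y := rfl

/-- A Lipschitz path is Lipschitz for the intrinsic metric, with the same constant. -/
theorem lipschitzWith_intrinsic {X : Type*} [EMetricSpace X] [RectifiablyConnected X] {γ : I → X}
    {K : ℝ≥0} (h : LipschitzWith K γ) : LipschitzWith K (fun u => toIntrinsic (γ u)) := by
  intro u w
  -- The piece of `γ` between the times `u` and `w`, rescaled to the unit interval, has Lipschitz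
  -- constant `K * |w - u|`; this bounds its length and hence the intrinsic distance of its ends.
  have hl := h.comp (lipschitzWith_segPoint u w)
  let p : Path (γ u) (γ w) := ⟨⟨fun t => γ (segPoint u w t), hl.continuous⟩,
    congrArg γ (Subtype.ext (by simp [segPoint])), congrArg γ (Subtype.ext (by simp [segPoint]))⟩
  rw [edist_toIntrinsic]
  refine (iInf_le (fun p : Path (γ u) (γ w) => pathLength p) p).trans
    ((pathLength_le_of_lipschitz (γ := p) hl).trans (le_of_eq ?_))
  rw [ENNReal.coe_mul, edist_dist u w, Subtype.dist_eq, Real.dist_eq, abs_sub_comm]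
  congr 1
  rw [ENNReal.ofReal]
  congr 1
  ext
  simp

end Lipschitz

/-! ### The lower bound for lengths of paths between colliding pairs. -/

section LowerBound
variable {ℓ : Fin 3 → ℝ}

theorem cosTerm_self_pos (x : Conf2 (YGraph ℓ)) : 0 < cosTerm x x := by
  have := confRadius_pos x
  rw [cosTerm, dist_self]
  nlinarith

/-- At a non-acute angle the squared distance is at least the sum of the squared radii, and the
radius of `y` is positive. -/
theorem confRadius_lt_dist {x y : Conf2 (YGraph ℓ)} (h : cosTerm x y ≤ 0) :
    confRadius x < dist x y := by
  rw [cosTerm] at h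
  exact lt_of_pow_lt_pow_left₀ 2 dist_nonneg (by nlinarith [pow_pos (confRadius_pos y) 2])

variable [hℓ : Fact (∀ i, 0 < ℓ i)]

theorem geod_symm (a b : YGraph ℓ) (u : I) : geod b a u = geod a b (σ u) := by
  refine YGraph.ext_coord fun k => ?_
  rw [geod_coord, geod_coord, max_comm (_ - _), dist_comm, coe_symm_eq, sub_sub_cancel]

theorem NoCollision.symm {x y : Conf2 (YGraph ℓ)} (h : NoCollision x y) : NoCollision y x :=
  fun u => by rw [geod_symm x.1.fst, geod_symm x.1.snd]; exact h _

/-- Otherwise some time `m` splits the path into a part at acute angles with its start and a part at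
acute angles with its end. Neither end then collides with `γ m`, and `noCollision_trans` applies at
`γ m`. -/
theorem exists_cosTerm_nonpos {γ : I → Conf2 (YGraph ℓ)} (hγ : Continuous γ)
    (h : ¬ NoCollision (γ 0) (γ 1)) :
    ∃ u w, u ≤ w ∧ cosTerm (γ 0) (γ u) ≤ 0 ∧ cosTerm (γ w) (γ 1) ≤ 0 := by
  by_contra! hcon
  have c0 : Continuous fun u => cosTerm (γ 0) (γ u) := (continuous_cosTerm _).comp hγ
  have c1 : Continuous fun u => cosTerm (γ u) (γ 1) := by
    simp only [cosTerm_comm _ (γ 1)]; exact (continuous_cosTerm _).comp hγ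
  obtain ⟨m, hm0, hm1⟩ : ∃ m, (∀ u ≤ m, 0 < cosTerm (γ 0) (γ u)) ∧
      ∀ u ≥ m, 0 < cosTerm (γ u) (γ 1) := by
    by_cases hS : {u | cosTerm (γ 0) (γ u) ≤ 0}.Nonempty
    -- At the first time `c` of a non-acute angle with the start, and at all later times, the angle
    -- with the end is acute. By openness this already holds slightly earlier, which leaves room for
    -- `m < c`.
    · obtain ⟨c, hc, hmin⟩ := (isClosed_le c0 continuous_const).isCompact.exists_isLeast hS
      have hc0 : 0 < c := by
        refine lt_of_le_of_ne c.2.1 fun e => ?_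
        rw [mem_ofPred_eq, ← e] at hc
        exact absurd hc (cosTerm_self_pos _).not_ge
      have hnhds : {u | 0 < cosTerm (γ u) (γ 1)} ∈ 𝓝 c :=
        (isOpen_lt continuous_const c1).mem_nhds (hcon c c le_rfl hc)
      obtain ⟨l, hl, hsub⟩ := exists_Ioc_subset_of_mem_nhds hnhds ⟨0, hc0⟩
      obtain ⟨m, hlm, hmc⟩ := exists_between hl
      refine ⟨m, fun u hu => not_le.1 fun hu' => ?_, fun u hu => ?_⟩
      · exact absurd (hmin hu') (hu.trans_lt hmc).not_ge
      · rcases le_total u c with h | h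
        · exact hsub ⟨hlm.trans_le hu, h⟩
        · exact hcon c u h hc
    · refine ⟨1, fun u _ => not_le.1 fun hu => hS ⟨u, hu⟩, fun u hu => ?_⟩
      rw [le_antisymm u.2.2 hu |> fun e => (Subtype.ext e : u = 1)]
      exact cosTerm_self_pos _
  have n1 : NoCollision (γ 0) (γ m) := by
    -- The path stopped at time `m`; for `n2` the reversed path is stopped there.
    have := noCollision_of_path (γ := fun u => γ (min u m)) (by fun_prop) fun u => by
      rw [min_eq_left (a := (0 : I)) m.2.1]; exact hm0 _ (min_le_right _ _)
    rwa [min_eq_left (a := (0 : I)) m.2.1, min_eq_right (a := (1 : I)) m.2.2] at this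
  have n2 : NoCollision (γ 1) (γ m) := by
    have := noCollision_of_path (γ := fun u => γ (max (σ u) m)) (by fun_prop) fun u => by
      rw [symm_zero, max_eq_left (a := (1 : I)) m.2.2, cosTerm_comm]; exact hm1 _ (le_max_right _ _)
    rwa [symm_zero, symm_one, max_eq_left (a := (1 : I)) m.2.2,
      max_eq_right (a := (0 : I)) m.2.1] at this
  exact h (noCollision_trans (hm0 m le_rfl) (hm1 m le_rfl) n1 n2.symm)

/-- If the geodesic motions collide, then every motion without collision is longer than the path
through the vertex. -/
theorem lt_pathLength {x y : Conf2 (YGraph ℓ)} (γ : Path x y) (h : ¬ NoCollision x y) :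
    ENNReal.ofReal (confRadius x + confRadius y) < pathLength γ := by
  obtain ⟨u, w, huw, h1, h2⟩ := exists_cosTerm_nonpos γ.continuous (by simpa using h)
  rw [γ.source] at h1
  rw [γ.target, cosTerm_comm] at h2
  have l1 := confRadius_lt_dist h1
  have l2 := confRadius_lt_dist h2
  -- The part up to `u` is longer than `confRadius x`; the part after `u` contains the piece from
  -- `w` to the end, which is longer than `confRadius y`.
  have e : pathLength γ = eVariationOn γ (univ ∩ Icc 0 u) + eVariationOn γ (univ ∩ Icc u 1) := by
    rw [eVariationOn.Icc_add_Icc (γ : I → _) (a := 0) (b := u) (c := 1) u.2.1 u.2.2 (mem_univ u), univ_inter, pathLength]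
    congr 1
    exact (eq_univ_of_forall fun t => ⟨t.2.1, t.2.2⟩ : Icc (0 : I) 1 = univ).symm
  have v1 : edist x (γ u) ≤ eVariationOn γ (univ ∩ Icc 0 u) := by
    have := eVariationOn.edist_le (γ : I → _) (s := univ ∩ Icc 0 u) (x := 0) (y := u)
      ⟨mem_univ _, le_rfl, u.2.1⟩ ⟨mem_univ _, u.2.1, le_rfl⟩
    rwa [γ.source] at this
  have v2 : edist (γ w) y ≤ eVariationOn γ (univ ∩ Icc u 1) := by
    have := eVariationOn.edist_le (γ : I → _) (s := univ ∩ Icc u 1) (x := w) (y := 1)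
      ⟨mem_univ _, huw, w.2.2⟩ ⟨mem_univ _, u.2.2, le_rfl⟩
    rwa [γ.target] at this
  rw [e]
  refine lt_of_lt_of_le ?_ (add_le_add v1 v2)
  rw [edist_dist, edist_dist, ← ENNReal.ofReal_add dist_nonneg dist_nonneg, dist_comm (γ w)]
  exact (ENNReal.ofReal_lt_ofReal_iff (by linarith [confRadius_nonneg x, confRadius_nonneg y])).2
    (add_lt_add l1 l2)

end LowerBound

theorem toIntrinsic_dist_ge {X : Type*} [MetricSpace X] [RectifiablyConnected X] (x y : X) :
    dist x y ≤ dist (toIntrinsic x) (toIntrinsic y) := by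
  have h : edist x y ≤ edist (toIntrinsic x) (toIntrinsic y) := edist_le_intrinsicEDist x y
  rw [edist_dist, edist_dist] at h
  exact (ENNReal.ofReal_le_ofReal_iff dist_nonneg).1 h

theorem isClosed_exists_compact {X Y : Type*} [TopologicalSpace X] [TopologicalSpace Y]
    [CompactSpace Y] {s : Set (X × Y)} (hs : IsClosed s) : IsClosed {x | ∃ y, (x, y) ∈ s} := by
  convert isClosedMap_fst_of_compactSpace s hs using 1
  ext x
  simp

/-! ### Intrinsic distance without collision, its topology, and radial contraction. -/

section Scaling
variable {ℓ : Fin 3 → ℝ}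

theorem continuous_conf_fst : Continuous fun x : Conf2 (YGraph ℓ) => x.1.fst :=
  (WithLp.continuous_fst 2 _ _).comp continuous_subtype_val

theorem continuous_conf_snd : Continuous fun x : Conf2 (YGraph ℓ) => x.1.snd :=
  (WithLp.continuous_snd 2 _ _).comp continuous_subtype_val

/-- A configuration given by its two points. -/
def mkConf (a b : YGraph ℓ) (h : a ≠ b) : Conf2 (YGraph ℓ) := ⟨WithLp.toLp 2 (a, b), h⟩

@[simp] theorem mkConf_fst (a b : YGraph ℓ) (h : a ≠ b) : (mkConf a b h).1.fst = a := rfl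

@[simp] theorem mkConf_snd (a b : YGraph ℓ) (h : a ≠ b) : (mkConf a b h).1.snd = b := rfl

theorem Conf2.ext {x y : Conf2 (YGraph ℓ)} (h : x.1.fst = y.1.fst) (h' : x.1.snd = y.1.snd) :
    x = y := Subtype.ext (WithLp.ofLp_injective 2 (Prod.ext h h'))

theorem continuous_mkConf {X : Type*} [TopologicalSpace X] {f g : X → YGraph ℓ}
    (hf : Continuous f) (hg : Continuous g) (h : ∀ x, f x ≠ g x) :
    Continuous fun x => mkConf (f x) (g x) (h x) :=
  Continuous.subtype_mk ((WithLp.prod_continuous_toLp 2 _ _).comp (hf.prodMk hg)) _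

theorem dist_mkConf_le {a b a' b' : YGraph ℓ} (h h') {c A B : ℝ} (hc : 0 ≤ c)
    (ha : dist a a' ≤ c * A) (hb : dist b b' ≤ c * B) :
    dist (mkConf a b h) (mkConf a' b' h') ≤ c * √(A ^ 2 + B ^ 2) := by
  refine (abs_le_of_sq_le_sq' ?_ (by positivity)).2
  rw [conf_dist_sq, mul_pow, Real.sq_sqrt (by positivity), mul_add, ← mul_pow, ← mul_pow]
  exact add_le_add (pow_le_pow_left₀ dist_nonneg ha 2) (pow_le_pow_left₀ dist_nonneg hb 2)

theorem conf_dist_eq_sqrt (x y : Conf2 (YGraph ℓ)) :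
    dist x y = √(dist x.1.fst y.1.fst ^ 2 + dist x.1.snd y.1.snd ^ 2) := by
  rw [← conf_dist_sq, Real.sqrt_sq dist_nonneg]

theorem exists_coord_lt (x : Conf2 (YGraph ℓ)) :
    ∃ i, x.1.snd.1 i < x.1.fst.1 i ∨ x.1.fst.1 i < x.1.snd.1 i := by
  by_contra! h
  exact x.2 (YGraph.ext_coord fun k => le_antisymm (h k).1 (h k).2)

variable [hℓ : Fact (∀ i, 0 < ℓ i)]

/-- The simultaneous motion of both points along geodesics. -/
noncomputable def confGeod {x y : Conf2 (YGraph ℓ)} (h : NoCollision x y) (u : I) :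
    Conf2 (YGraph ℓ) := mkConf (geod x.1.fst y.1.fst u) (geod x.1.snd y.1.snd u) (h u)

theorem confGeod_zero {x y : Conf2 (YGraph ℓ)} (h : NoCollision x y) : confGeod h 0 = x :=
  Conf2.ext (geod_zero _ _) (geod_zero _ _)

theorem confGeod_one {x y : Conf2 (YGraph ℓ)} (h : NoCollision x y) : confGeod h 1 = y :=
  Conf2.ext (geod_one _ _) (geod_one _ _)

theorem lipschitzWith_confGeod {x y : Conf2 (YGraph ℓ)} (h : NoCollision x y) :
    LipschitzWith (nndist x y) (confGeod h) := by
  refine LipschitzWith.of_dist_le_mul fun u w => ?_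
  rw [coe_nndist, mul_comm, Subtype.dist_eq u, Real.dist_eq, conf_dist_eq_sqrt x y]
  exact dist_mkConf_le _ _ (abs_nonneg _) (dist_geod_le _ _ _ _) (dist_geod_le _ _ _ _)

/-- The straight motion is a path of length at most `dist x y`, and no path is shorter. -/
theorem dist_toIntrinsic {x y : Conf2 (YGraph ℓ)} (h : NoCollision x y) :
    dist (toIntrinsic x) (toIntrinsic y) = dist x y := by
  refine le_antisymm ?_ (toIntrinsic_dist_ge x y)
  have := (lipschitzWith_intrinsic (lipschitzWith_confGeod h)).dist_le_mul 0 1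
  simpa [confGeod_zero, confGeod_one, Subtype.dist_eq] using this

theorem continuous_geod_comp {X : Type*} [TopologicalSpace X] {f g : X → YGraph ℓ} {h : X → I}
    (hf : Continuous f) (hg : Continuous g) (hh : Continuous h) :
    Continuous fun x => geod (f x) (g x) (h x) :=
  continuous_geod.comp ((hf.prodMk hg).prodMk hh)

/-- The colliding pairs are the projection, along the compact time interval, of the closed set of
pairs and times at which the two points coincide. -/
theorem isOpen_noCollision :
    IsOpen {p : Conf2 (YGraph ℓ) × Conf2 (YGraph ℓ) | NoCollision p.1 p.2} := by
  have hc : IsClosed {q : (Conf2 (YGraph ℓ) × Conf2 (YGraph ℓ)) × I |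
      geod q.1.1.1.fst q.1.2.1.fst q.2 = geod q.1.1.1.snd q.1.2.1.snd q.2} :=
    isClosed_eq
      (continuous_geod_comp (continuous_conf_fst.comp (by fun_prop))
        (continuous_conf_fst.comp (by fun_prop)) continuous_snd)
      (continuous_geod_comp (continuous_conf_snd.comp (by fun_prop))
        (continuous_conf_snd.comp (by fun_prop)) continuous_snd)
  convert (isClosed_exists_compact hc).isOpen_compl using 1
  ext p
  simp [NoCollision]

/-- The intrinsic metric induces the given topology. -/
def intrinsicHomeo (ℓ : Fin 3 → ℝ) [Fact (∀ i, 0 < ℓ i)] :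
    Conf2 (YGraph ℓ) ≃ₜ Intrinsic (Conf2 (YGraph ℓ)) where
  toFun := toIntrinsic
  invFun x := x
  left_inv _ := rfl
  right_inv _ := rfl
  continuous_toFun := by
    rw [continuous_iff_continuousAt]
    intro x
    -- A configuration does not collide with itself, hence not with its neighbours, so both metrics
    -- agree on distances from `x` nearby.
    have hev : ∀ᶠ y in 𝓝 x, NoCollision y x :=
      ((isOpen_noCollision (ℓ := ℓ)).preimage (Continuous.prodMk_left x)).mem_nhds
        (noCollision_self x)
    refine tendsto_iff_dist_tendsto_zero.2 ?_
    refine (tendsto_iff_dist_tendsto_zero.1 (tendsto_id (x := 𝓝 x))).congr' ?_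
    exact hev.mono fun y hy => (dist_toIntrinsic hy).symm
  continuous_invFun := by
    refine LipschitzWith.continuous (K := 1) fun x y => ?_
    rw [ENNReal.coe_one, one_mul]
    exact edist_le_intrinsicEDist (X := Conf2 (YGraph ℓ)) x y

theorem continuous_toIntrinsic : Continuous (toIntrinsic : Conf2 (YGraph ℓ) → _) :=
  (intrinsicHomeo ℓ).continuous

/-- Contraction of the graph towards the vertex. -/
def scalePoint (s : I) (a : YGraph ℓ) : YGraph ℓ :=
  mkPoint (fun k => s * a.1 k) (fun k => mul_nonneg s.2.1 (coord_nonneg a k))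
    (fun k => (mul_le_of_le_one_left (coord_nonneg a k) s.2.2).trans (coord_le a k))
    (by obtain ⟨i, hi⟩ := exists_arm a; exact ⟨i, fun k hk => by rw [hi k hk, mul_zero]⟩)

theorem scalePoint_coord (s : I) (a : YGraph ℓ) (k : Fin 3) :
    (scalePoint s a).1 k = s * a.1 k := rfl

theorem scalePoint_ne {s : I} (hs : 0 < s) {a b : YGraph ℓ} (h : a ≠ b) :
    scalePoint s a ≠ scalePoint s b := fun e => h <| YGraph.ext_coord fun k =>
  mul_left_cancel₀ (b := a.1 k) (Subtype.coe_lt_coe.2 hs).ne'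
    (by rw [← scalePoint_coord s a, e, scalePoint_coord])

theorem dist_scalePoint (s : I) (a b : YGraph ℓ) :
    dist (scalePoint s a) (scalePoint s b) = s * dist a b := by
  rw [dist_eq_sum, dist_eq_sum, Finset.mul_sum]
  refine Finset.sum_congr rfl fun k _ => ?_
  rw [scalePoint_coord, scalePoint_coord, ← mul_sub, abs_mul, abs_of_nonneg s.2.1]

theorem dist_scalePoint_left (s t : I) (a : YGraph ℓ) :
    dist (scalePoint s a) (scalePoint t a) = |(s : ℝ) - t| * radius a := by
  rw [dist_eq_sum, radius, Finset.mul_sum]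
  refine Finset.sum_congr rfl fun k _ => ?_
  rw [scalePoint_coord, scalePoint_coord, ← sub_mul, abs_mul, abs_of_nonneg (coord_nonneg a k)]

/-- Contraction of configurations towards the vertex. -/
def scaleConf (s : I) (hs : 0 < s) (x : Conf2 (YGraph ℓ)) : Conf2 (YGraph ℓ) :=
  mkConf (scalePoint s x.1.fst) (scalePoint s x.1.snd) (scalePoint_ne hs x.2)

theorem scaleConf_one (x : Conf2 (YGraph ℓ)) : scaleConf 1 zero_lt_one x = x :=
  Conf2.ext (YGraph.ext_coord fun _ => one_mul _) (YGraph.ext_coord fun _ => one_mul _)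

theorem lipschitzWith_scaleConf (s : I) (hs : 0 < s) :
    LipschitzWith (Real.toNNReal s) (scaleConf s hs : Conf2 (YGraph ℓ) → _) := by
  refine LipschitzWith.of_dist_le_mul fun x y => ?_
  rw [Real.coe_toNNReal _ s.2.1, conf_dist_eq_sqrt x y]
  exact dist_mkConf_le _ _ s.2.1 (dist_scalePoint _ _ _).le (dist_scalePoint _ _ _).le

/-- Contraction keeps distinct points distinct, so it acts on the competing paths and multiplies
their lengths by at most `s`. -/
theorem dist_toIntrinsic_scaleConf (s : I) (hs : 0 < s) (x y : Conf2 (YGraph ℓ)) :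
    dist (toIntrinsic (scaleConf s hs x)) (toIntrinsic (scaleConf s hs y)) ≤
      s * dist (toIntrinsic x) (toIntrinsic y) := by
  have hl := lipschitzWith_scaleConf (ℓ := ℓ) s hs
  have h : edist (toIntrinsic (scaleConf s hs x)) (toIntrinsic (scaleConf s hs y)) ≤
      (Real.toNNReal s : ℝ≥0∞) * edist (toIntrinsic x) (toIntrinsic y) := by
    rw [edist_toIntrinsic, edist_toIntrinsic, intrinsicEDist, intrinsicEDist, ENNReal.mul_iInf_of_ne]
    · refine le_iInf fun γ => (iInf_le _ (γ.map hl.continuous)).trans ?_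
      exact (hl.lipschitzOnWith (s := univ)).comp_eVariationOn_le (mapsTo_univ _ _)
    · rw [ENNReal.coe_ne_zero]
      exact (Real.toNNReal_pos.2 (Subtype.coe_lt_coe.2 hs)).ne'
    · exact ENNReal.coe_ne_top
  rw [edist_dist, edist_dist, ← ENNReal.ofReal, ← ENNReal.ofReal_mul s.2.1] at h
  exact (ENNReal.ofReal_le_ofReal_iff (mul_nonneg s.2.1 dist_nonneg)).1 h

/-- Two contractions of one configuration have the same order on an arm, hence do not collide, and
the intrinsic distance is the product distance. -/
theorem dist_toIntrinsic_scaleConf_left (s t : I) (hs : 0 < s) (ht : 0 < t)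
    (x : Conf2 (YGraph ℓ)) :
    dist (toIntrinsic (scaleConf s hs x)) (toIntrinsic (scaleConf t ht x)) ≤
      |(s : ℝ) - t| * confRadius x := by
  have hs' : 0 < (s : ℝ) := hs
  have ht' : 0 < (t : ℝ) := ht
  rw [dist_toIntrinsic]
  · exact dist_mkConf_le _ _ (abs_nonneg _) (dist_scalePoint_left _ _ _).le
      (dist_scalePoint_left _ _ _).le
  · obtain ⟨i, hi | hi⟩ := exists_coord_lt x
    · exact noCollision_of_pos (i := i) (mul_lt_mul_of_pos_left hi hs')
        (mul_lt_mul_of_pos_left hi ht')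
    · exact noCollision_swap.1 (noCollision_of_pos (i := i) (mul_lt_mul_of_pos_left hi hs')
        (mul_lt_mul_of_pos_left hi ht'))

end Scaling

/-! ### The cone point of the completion and the intrinsic distance of colliding pairs. -/

section Cone
variable {ℓ : Fin 3 → ℝ} [hℓ : Fact (∀ i, 0 < ℓ i)]

/-- The completion of the space of configurations with the intrinsic metric. -/
abbrev ConfCompletion (ℓ : Fin 3 → ℝ) [Fact (∀ i, 0 < ℓ i)] : Type :=
  UniformSpace.Completion (Intrinsic (Conf2 (YGraph ℓ)))

/-- A configuration, as a point of the completion. -/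
noncomputable def toCompletion (x : Conf2 (YGraph ℓ)) : ConfCompletion ℓ := (toIntrinsic x : _)

theorem dist_toCompletion (x y : Conf2 (YGraph ℓ)) :
    dist (toCompletion x) (toCompletion y) = dist (toIntrinsic x) (toIntrinsic y) :=
  UniformSpace.Completion.dist_eq _ _

/-- The contractions of one configuration to scales tending to `0` form a Cauchy sequence. Its limit
serves all configurations, because the contractions of two of them to scale `t` are within `t` times
their finite distance. -/
theorem exists_conePoint (ℓ : Fin 3 → ℝ) [Fact (∀ i, 0 < ℓ i)] : ∃ o : ConfCompletion ℓ, ∀ s hs x,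
    dist o (toCompletion (scaleConf s hs x)) ≤ s * confRadius x := by
  let x₀ : Conf2 (YGraph ℓ) := fstNode ℓ 0
  let t : ℕ → I := fun n => ⟨1 / ((n : ℝ) + 1), by positivity, by
    rw [div_le_one (by positivity)]; linarith [n.cast_nonneg (α := ℝ)]⟩
  have ht : ∀ n, 0 < t n := fun n => by
    change (0 : ℝ) < 1 / ((n : ℝ) + 1); positivity
  have tlim : Tendsto (fun n => (t n : ℝ)) atTop (𝓝 0) := tendsto_one_div_add_atTop_nhds_zero_nat
  let f : ℕ → ConfCompletion ℓ := fun n => toCompletion (scaleConf (t n) (ht n) x₀)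
  have hf : CauchySeq f := by
    refine cauchySeq_of_le_tendsto_0 (fun N => t N * confRadius x₀) (fun n m N hn hm => ?_) ?_
    · rw [dist_toCompletion]
      refine (dist_toIntrinsic_scaleConf_left _ _ _ _ _).trans ?_
      refine mul_le_mul_of_nonneg_right ?_ (confRadius_nonneg _)
      have h1 : (t n : ℝ) ≤ t N := one_div_le_one_div_of_le (by positivity) (by norm_cast; omega)
      have h2 : (t m : ℝ) ≤ t N := one_div_le_one_div_of_le (by positivity) (by norm_cast; omega)
      exact abs_sub_le_iff.2 ⟨by linarith [(t m).2.1], by linarith [(t n).2.1]⟩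
    · simpa using tlim.mul_const (confRadius x₀)
  obtain ⟨o, ho⟩ := cauchySeq_tendsto_of_complete hf
  refine ⟨o, fun s hs x => ?_⟩
  -- Go from `x₀` to `x` at scale `t n`, then along the ray of `x` to scale `s`.
  refine le_of_tendsto_of_tendsto (ho.dist tendsto_const_nhds) (?_ : Tendsto (fun n =>
    (t n : ℝ) * dist (toIntrinsic x₀) (toIntrinsic x) + |(t n : ℝ) - s| * confRadius x) atTop _)
    (Eventually.of_forall fun n => ?_)
  · have := (tlim.mul_const (dist (toIntrinsic x₀) (toIntrinsic x))).add
      (((tlim.sub_const (s : ℝ)).abs).mul_const (confRadius x))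
    simpa [abs_of_nonneg s.2.1] using this
  · refine (dist_triangle _ (toCompletion (scaleConf (t n) (ht n) x)) _).trans (add_le_add ?_ ?_)
    · rw [dist_toCompletion]; exact dist_toIntrinsic_scaleConf _ _ _ _
    · rw [dist_toCompletion]; exact dist_toIntrinsic_scaleConf_left _ _ _ _ _

/-- The point of the completion at which both points are at the vertex. -/
noncomputable def conePoint (ℓ : Fin 3 → ℝ) [Fact (∀ i, 0 < ℓ i)] : ConfCompletion ℓ :=
  (exists_conePoint ℓ).choose

/-- Contraction of configurations, extended to the cone point. -/
noncomputable def coneMap (s : I) (x : Conf2 (YGraph ℓ)) : ConfCompletion ℓ :=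
  if h : 0 < s then toCompletion (scaleConf s h x) else conePoint ℓ

theorem coneMap_of_pos {s : I} (h : 0 < s) (x : Conf2 (YGraph ℓ)) :
    coneMap s x = toCompletion (scaleConf s h x) := dif_pos h

theorem coneMap_zero (x : Conf2 (YGraph ℓ)) : coneMap 0 x = conePoint ℓ := dif_neg (lt_irrefl _)

theorem coneMap_one (x : Conf2 (YGraph ℓ)) : coneMap 1 x = toCompletion x := by
  rw [coneMap_of_pos zero_lt_one, scaleConf_one]

theorem dist_conePoint_le (s : I) (x : Conf2 (YGraph ℓ)) :
    dist (conePoint ℓ) (coneMap s x) ≤ s * confRadius x := by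
  by_cases h : 0 < s
  · rw [coneMap_of_pos h]; exact (exists_conePoint ℓ).choose_spec s h x
  · rw [coneMap, dif_neg h, dist_self]; exact mul_nonneg s.2.1 (confRadius_nonneg x)

theorem dist_coneMap_le (s t : I) (x y : Conf2 (YGraph ℓ)) :
    dist (coneMap s x) (coneMap t y) ≤
      |(s : ℝ) - t| * confRadius x + t * dist (toIntrinsic x) (toIntrinsic y) := by
  rcases s.2.1.eq_or_lt with hs | hs
  · have hs' : s = 0 := Subtype.ext hs.symm
    rw [hs', coneMap_zero]
    refine (dist_conePoint_le t y).trans ?_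
    have h1 := (confRadius_sub_le y x).trans
      ((dist_comm y x).le.trans (toIntrinsic_dist_ge x y))
    have h2 : |((0 : I) : ℝ) - t| = t := by simp [abs_of_nonneg t.2.1]
    rw [h2, ← mul_add]
    exact mul_le_mul_of_nonneg_left (by linarith) t.2.1
  rcases t.2.1.eq_or_lt with ht | ht
  · have ht' : t = 0 := Subtype.ext ht.symm
    rw [ht', coneMap_zero, dist_comm]
    refine (dist_conePoint_le s x).trans ?_
    simp [abs_of_pos hs]
  · rw [coneMap_of_pos hs, coneMap_of_pos ht, dist_toCompletion]
    refine (dist_triangle _ (toIntrinsic (scaleConf t ht x)) _).trans (add_le_add ?_ ?_)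
    · exact dist_toIntrinsic_scaleConf_left _ _ _ _ _
    · exact dist_toIntrinsic_scaleConf _ _ _ _

theorem dist_toIntrinsic_le (x y : Conf2 (YGraph ℓ)) :
    dist (toIntrinsic x) (toIntrinsic y) ≤ confRadius x + confRadius y := by
  rw [← dist_toCompletion, ← coneMap_one, ← coneMap_one]
  refine (dist_triangle_left _ _ (conePoint ℓ)).trans (add_le_add ?_ ?_)
  · simpa using dist_conePoint_le 1 x
  · simpa using dist_conePoint_le 1 y

/-- The bound from above is the route through the cone point, the one from below is `lt_pathLength`.
-/
theorem dist_toIntrinsic_of_collision {x y : Conf2 (YGraph ℓ)} (h : ¬ NoCollision x y) :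
    dist (toIntrinsic x) (toIntrinsic y) = confRadius x + confRadius y := by
  refine le_antisymm (dist_toIntrinsic_le x y) ?_
  have : ENNReal.ofReal (confRadius x + confRadius y) ≤ edist (toIntrinsic x) (toIntrinsic y) :=
    le_iInf fun γ => (lt_pathLength γ h).le
  rw [edist_dist] at this
  exact (ENNReal.ofReal_le_ofReal_iff dist_nonneg).1 this

theorem continuous_coneMap : Continuous fun p : I × Conf2 (YGraph ℓ) => coneMap p.1 p.2 := by
  rw [continuous_iff_continuousAt]
  rintro ⟨s, x⟩
  refine tendsto_iff_dist_tendsto_zero.2 ?_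
  have hc : Continuous fun p : I × Conf2 (YGraph ℓ) =>
      |(s : ℝ) - p.1| * confRadius x + p.1 * dist (toIntrinsic x) (toIntrinsic p.2) := by
    have := continuous_toIntrinsic (ℓ := ℓ)
    fun_prop
  have h := hc.tendsto (s, x)
  simp only [sub_self, abs_zero, zero_mul, dist_self, mul_zero, add_zero] at h
  exact squeeze_zero (fun _ => dist_nonneg)
    (fun p => by rw [dist_comm]; exact dist_coneMap_le _ _ _ _) h

end Cone

/-! ### Medians of triples, and segments in `ℝ³` avoiding the diagonal. -/

section Median

/-- The median of three numbers. -/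
def med (z : Fin 3 → ℝ) : ℝ := max (min (z 0) (z 1)) (min (max (z 0) (z 1)) (z 2))

theorem med_neg (z : Fin 3 → ℝ) : med (-z) = -med z := by
  simp only [med, Pi.neg_apply, min_neg_neg, max_neg_neg]
  rcases le_total (z 0) (z 1) with h | h <;> rcases le_total (z 1) (z 2) with h' | h' <;>
  rcases le_total (z 0) (z 2) with h'' | h'' <;> simp [h, h', h''] <;> linarith

theorem med_smul {c : ℝ} (hc : 0 ≤ c) (z : Fin 3 → ℝ) : med (fun k => c * z k) = c * med z := by
  simp only [med, ← mul_min_of_nonneg _ _ hc, ← mul_max_of_nonneg _ _ hc]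

theorem med_add_const (z : Fin 3 → ℝ) (c : ℝ) : med (fun k => z k + c) = med z + c := by
  simp only [med, min_add_add_right, max_add_add_right]

theorem exists_le_med (z : Fin 3 → ℝ) : ∃ i, ∀ k, k ≠ i → z k ≤ med z := by
  have key : ∀ i, (∀ k, k ≠ i → z k ≤ z i) → ∀ k, k ≠ i → z k ≤ med z := by
    intro i hi k hk
    simp only [med]
    fin_cases i <;> fin_cases k <;> simp_all [Fin.forall_fin_succ]
  obtain ⟨i, hi⟩ := Finite.exists_max z
  exact ⟨i, key i fun k _ => hi k⟩

theorem med_eq_zero {z : Fin 3 → ℝ} {i j : Fin 3} (hij : i ≠ j) (hi : 0 ≤ z i) (hj : z j ≤ 0)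
    (h : ∀ k, k ≠ i → k ≠ j → z k = 0) : med z = 0 := by
  simp only [med]
  fin_cases i <;> fin_cases j <;> simp_all [Fin.forall_fin_succ]

theorem abs_med_sub_le (z w : Fin 3 → ℝ) : |med z - med w| ≤ dist z w := by
  have h : ∀ k, |z k - w k| ≤ dist z w := fun k => dist_le_pi_dist z w k
  refine (abs_max_sub_max_le_max _ _ _ _).trans (max_le ?_ ?_)
  · exact (abs_min_sub_min_le_max _ _ _ _).trans (max_le (h 0) (h 1))
  · exact (abs_min_sub_min_le_max _ _ _ _).trans (max_le
      ((abs_max_sub_max_le_max _ _ _ _).trans (max_le (h 0) (h 1))) (h 2))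

/-- Not all coordinates are equal. -/
def Nonconst (z : Fin 3 → ℝ) : Prop := z 0 ≠ z 1 ∨ z 1 ≠ z 2

theorem isOpen_nonconst : IsOpen {z : Fin 3 → ℝ | Nonconst z} :=
  (isOpen_ne_fun (continuous_apply 0) (continuous_apply 1)).union
    (isOpen_ne_fun (continuous_apply 1) (continuous_apply 2))

theorem Nonconst.exists_ne_med {z : Fin 3 → ℝ} (h : Nonconst z) : ∃ k, z k ≠ med z := by
  by_contra! hcon
  rcases h with h | h
  · exact h ((hcon 0).trans (hcon 1).symm)
  · exact h ((hcon 1).trans (hcon 2).symm)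

/-- Cyclic permutation of the coordinates. -/
def rot (z : Fin 3 → ℝ) : Fin 3 → ℝ := ![z 1, z 2, z 0]

theorem continuous_rot : Continuous rot := by
  refine continuous_pi fun k => ?_
  fin_cases k
  · exact continuous_apply 1
  · exact continuous_apply 2
  · exact continuous_apply 0

/-- The segment from `z` to `w`. -/
def seg (z w : Fin 3 → ℝ) (u : I) : Fin 3 → ℝ := fun k => (1 - u) * z k + u * w k

/-- Modulo the diagonal, `rot` is a rotation by 120 degrees, so the segment misses the origin. In
terms of the differences of successive coordinates, the point at `u` is the image of `z` under a
linear map of determinant `3u² - 3u + 1 > 0`. -/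
theorem nonconst_seg_rot {z : Fin 3 → ℝ} (hz : Nonconst z) (u : I) : Nonconst (seg z (rot z) u) := by
  by_contra h
  simp only [Nonconst, seg, rot, not_or, not_not, Matrix.cons_val] at h
  obtain ⟨h1, h2⟩ := h
  have hd : (1 - u : ℝ) * (1 - 2 * u) + u ^ 2 ≠ 0 := by nlinarith [sq_nonneg ((u : ℝ) - 1 / 2)]
  have p : z 0 - z 1 = 0 := by
    refine (mul_eq_zero.1 (?_ : (z 0 - z 1) * ((1 - u : ℝ) * (1 - 2 * u) + u ^ 2) = 0)).resolve_right hd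
    linear_combination (1 - 2 * (u : ℝ)) * h1 - u * h2
  have q : z 1 - z 2 = 0 := by
    refine (mul_eq_zero.1 (?_ : (z 1 - z 2) * ((1 - u : ℝ) * (1 - 2 * u) + u ^ 2) = 0)).resolve_right hd
    linear_combination (u : ℝ) * h1 + (1 - u) * h2
  rcases hz with h | h
  · exact h (sub_eq_zero.1 p)
  · exact h (sub_eq_zero.1 q)

/-- Modulo the diagonal, `rot z` and `-z` are 60 degrees apart; the determinant is now `u + (1 -
u)²`. Together with `nonconst_seg_rot` this completes a half-turn whose sense does not depend on
`z`. -/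
theorem nonconst_seg_rot_neg {z : Fin 3 → ℝ} (hz : Nonconst z) (u : I) :
    Nonconst (seg (rot z) (-z) u) := by
  by_contra h
  simp only [Nonconst, seg, rot, not_or, not_not, Matrix.cons_val, Pi.neg_apply] at h
  obtain ⟨h1, h2⟩ := h
  have hd : (u : ℝ) + (1 - u) ^ 2 ≠ 0 := by nlinarith [sq_nonneg ((u : ℝ) - 1 / 2)]
  have p : z 0 - z 1 = 0 := by
    refine (mul_eq_zero.1 (?_ : (z 0 - z 1) * ((u : ℝ) + (1 - u) ^ 2) = 0)).resolve_right hd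
    linear_combination -h1 - (1 - (u : ℝ)) * h2
  have q : z 1 - z 2 = 0 := by
    refine (mul_eq_zero.1 (?_ : (z 1 - z 2) * ((u : ℝ) + (1 - u) ^ 2) = 0)).resolve_right hd
    linear_combination (1 - (u : ℝ)) * h1 - u * h2
  rcases hz with h | h
  · exact h (sub_eq_zero.1 p)
  · exact h (sub_eq_zero.1 q)

theorem dist_seg_le (z w : Fin 3 → ℝ) (u v : I) : dist (seg z w u) (seg z w v) ≤
    |(u : ℝ) - v| * dist z w := by
  refine (dist_pi_le_iff (by positivity)).2 fun k => ?_
  have e : seg z w u k - seg z w v k = -((u - v) * (z k - w k)) := by simp only [seg]; ring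
  rw [Real.dist_eq, e, abs_neg, abs_mul]
  exact mul_le_mul_of_nonneg_left (dist_le_pi_dist z w k) (abs_nonneg _)

end Median

/-! ### Passing between configurations and directions in the plane `ℝ³ / diagonal`. -/

section Fold
variable {ℓ : Fin 3 → ℝ}

/-- The difference of the two points of a configuration, as vectors in space. -/
def confDiff (x : Conf2 (YGraph ℓ)) : Fin 3 → ℝ := fun k => x.1.fst.1 k - x.1.snd.1 k

theorem continuous_confDiff : Continuous (confDiff : Conf2 (YGraph ℓ) → _) :=
  continuous_pi fun k => (continuous_fst_coord k).sub (continuous_snd_coord k)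

/-- At most one coordinate of the difference is positive and at most one negative. Thus vanishing of
the median singles out a representative modulo the diagonal. -/
theorem med_confDiff (x : Conf2 (YGraph ℓ)) : med (confDiff x) = 0 := by
  rcases arm_cases x.1.fst x.1.snd with ⟨i, hi, hj⟩ | ⟨i, j, hij, hi, hj⟩
  · obtain ⟨j, hji⟩ : ∃ j, j ≠ i := exists_ne i
    have h0 : confDiff x j = 0 := by rw [confDiff, hi j hji, hj j hji, sub_zero]
    have hk : ∀ k, k ≠ i → k ≠ j → confDiff x k = 0 := fun k hk _ => by
      rw [confDiff, hi k hk, hj k hk, sub_zero]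
    rcases le_total 0 (confDiff x i) with h | h
    · exact med_eq_zero hji.symm h h0.le hk
    · exact med_eq_zero hji h0.ge h fun k h1 h2 => hk k h2 h1
  · refine med_eq_zero hij ?_ ?_ fun k h1 h2 => ?_
    · rw [confDiff, hj i hij, sub_zero]; exact coord_nonneg _ _
    · rw [confDiff, hi j hij.symm, zero_sub]; exact neg_nonpos.2 (coord_nonneg _ _)
    · rw [confDiff, hi k h1, hj k h2, sub_zero]

theorem nonconst_confDiff (x : Conf2 (YGraph ℓ)) : Nonconst (confDiff x) := by
  by_contra h
  simp only [Nonconst, not_or, not_not] at h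
  have h0 : ∀ k, confDiff x k = confDiff x 0 := fun k => by
    fin_cases k
    · rfl
    · exact h.1.symm
    · exact (h.1.trans h.2).symm
  have h1 := med_confDiff x
  simp only [med, h0, min_self, max_self] at h1
  exact x.2 (YGraph.ext_coord fun k => sub_eq_zero.1 ((h0 k).trans h1))

variable [hℓ : Fact (∀ i, 0 < ℓ i)]

/-- The point of the graph given by the excess of the largest coordinate over the median. -/
def foldPoint (ℓ : Fin 3 → ℝ) [hℓ : Fact (∀ i, 0 < ℓ i)] (z : Fin 3 → ℝ) : YGraph ℓ :=
  mkPoint (fun k => min (ℓ k) (max (z k - med z) 0)) (fun k => le_min (hℓ.out k).le (le_max_right _ _))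
    (fun k => min_le_left _ _) (by
      obtain ⟨i, hi⟩ := exists_le_med z
      refine ⟨i, fun k hk => ?_⟩
      rw [max_eq_right (sub_nonpos.2 (hi k hk)), min_eq_right (hℓ.out k).le])

theorem foldPoint_coord (z : Fin 3 → ℝ) (k : Fin 3) :
    (foldPoint ℓ z).1 k = min (ℓ k) (max (z k - med z) 0) := rfl

theorem foldPoint_coord_pos {z : Fin 3 → ℝ} {k : Fin 3} (h : med z < z k) :
    0 < (foldPoint ℓ z).1 k := lt_min (hℓ.out k) (lt_max_of_lt_left (sub_pos.2 h))

theorem foldPoint_coord_eq_zero {z : Fin 3 → ℝ} {k : Fin 3} (h : z k ≤ med z) :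
    (foldPoint ℓ z).1 k = 0 := by
  rw [foldPoint_coord, max_eq_right (sub_nonpos.2 h), min_eq_right (hℓ.out k).le]

theorem foldPoint_neg_coord_eq_zero {z : Fin 3 → ℝ} {k : Fin 3} (h : med z ≤ z k) :
    (foldPoint ℓ (-z)).1 k = 0 :=
  foldPoint_coord_eq_zero (by rw [med_neg]; exact neg_le_neg h)

theorem foldPoint_ne {z : Fin 3 → ℝ} (hz : Nonconst z) : foldPoint ℓ z ≠ foldPoint ℓ (-z) := by
  intro e
  obtain ⟨k, hk⟩ := hz.exists_ne_med
  rcases lt_or_gt_of_ne hk with h | h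
  · have h1 := foldPoint_coord_pos (ℓ := ℓ) (z := -z) (k := k) (by rw [med_neg]; exact neg_lt_neg h)
    rw [← e, foldPoint_coord_eq_zero h.le] at h1
    exact h1.false
  · have h1 := foldPoint_coord_pos (ℓ := ℓ) h
    rw [e, foldPoint_neg_coord_eq_zero h.le] at h1
    exact h1.false

/-- Each of the three coordinates changes by at most twice the distance, once for `z k` and once for
the median. -/
theorem dist_foldPoint_le (z w : Fin 3 → ℝ) : dist (foldPoint ℓ z) (foldPoint ℓ w) ≤ 6 * dist z w := by
  rw [dist_eq_sum]
  have h : ∀ k ∈ Finset.univ, |(foldPoint ℓ z).1 k - (foldPoint ℓ w).1 k| ≤ 2 * dist z w := by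
    intro k _
    rw [foldPoint_coord, foldPoint_coord]
    refine (abs_min_sub_min_le_max _ _ _ _).trans (max_le (by simp) ?_)
    refine (abs_max_sub_max_le_abs _ _ _).trans ?_
    have h1 : |z k - w k| ≤ dist z w := dist_le_pi_dist z w k
    have h2 := abs_med_sub_le z w
    rw [sub_sub_sub_comm]
    exact (abs_sub _ _).trans (by linarith)
  refine (Finset.sum_le_sum h).trans (le_of_eq ?_)
  simp
  ring

/-- The configuration, with both points on different arms or one at the vertex, given by the
differences of three numbers to their median. -/
def foldConf (ℓ : Fin 3 → ℝ) [Fact (∀ i, 0 < ℓ i)] (z : Fin 3 → ℝ) (hz : Nonconst z) :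
    Conf2 (YGraph ℓ) := mkConf (foldPoint ℓ z) (foldPoint ℓ (-z)) (foldPoint_ne hz)

theorem continuous_foldPoint : Continuous (foldPoint ℓ) :=
  (LipschitzWith.of_dist_le_mul (K := 6) fun z w => dist_foldPoint_le z w).continuous

theorem continuous_foldConf {X : Type*} [TopologicalSpace X] {f : X → Fin 3 → ℝ}
    (hf : Continuous f) (h : ∀ x, Nonconst (f x)) :
    Continuous fun x => foldConf ℓ (f x) (h x) :=
  continuous_mkConf (continuous_foldPoint.comp hf) (continuous_foldPoint.comp hf.neg) _

theorem dist_foldConf_le {z w : Fin 3 → ℝ} (hz : Nonconst z) (hw : Nonconst w) :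
    dist (foldConf ℓ z hz) (foldConf ℓ w hw) ≤ dist z w * √(6 ^ 2 + 6 ^ 2) := by
  refine dist_mkConf_le _ _ dist_nonneg ?_ ?_
  · rw [mul_comm]; exact dist_foldPoint_le z w
  · rw [mul_comm, ← dist_neg_neg z w]; exact dist_foldPoint_le _ _

/-- Folding removes what the two points have in common on an arm but keeps their strict order there,
so the straight motion links `x` to its folded form. -/
theorem noCollision_foldConf (x : Conf2 (YGraph ℓ)) :
    NoCollision x (foldConf ℓ (confDiff x) (nonconst_confDiff x)) := by
  have hm := med_confDiff x
  obtain ⟨i, hi | hi⟩ := exists_coord_lt x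
  · have hd : med (confDiff x) < confDiff x i := by rw [hm]; exact sub_pos.2 hi
    refine noCollision_of_pos hi ?_
    simp only [foldConf, mkConf_fst, mkConf_snd]
    rw [foldPoint_neg_coord_eq_zero hd.le]
    exact foldPoint_coord_pos hd
  · have hd : confDiff x i < med (confDiff x) := by rw [hm]; exact sub_neg.2 hi
    refine noCollision_swap.1 (noCollision_of_pos (i := i) hi ?_)
    simp only [foldConf, mkConf_fst, mkConf_snd, swap_fst, swap_snd]
    rw [foldPoint_coord_eq_zero hd.le]
    exact foldPoint_coord_pos (by rw [med_neg]; exact neg_lt_neg hd)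

/-- The pairs of configurations whose differences do not point in the same direction. -/
def rotSet (ℓ : Fin 3 → ℝ) [Fact (∀ i, 0 < ℓ i)] : Set (Conf2 (YGraph ℓ) × Conf2 (YGraph ℓ)) :=
  {p | ∀ u, Nonconst (seg (-confDiff p.1) (confDiff p.2) u)}

theorem continuous_seg {X : Type*} [TopologicalSpace X] {f g : X → Fin 3 → ℝ} {h : X → I}
    (hf : Continuous f) (hg : Continuous g) (hh : Continuous h) :
    Continuous fun x => seg (f x) (g x) (h x) := by
  unfold seg
  fun_prop

theorem isOpen_rotSet : IsOpen (rotSet ℓ) := by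
  have hc : Continuous fun q : (Conf2 (YGraph ℓ) × Conf2 (YGraph ℓ)) × I =>
      seg (-confDiff q.1.1) (confDiff q.1.2) q.2 :=
    continuous_seg (continuous_confDiff.comp (by fun_prop)).neg
      (continuous_confDiff.comp (by fun_prop)) continuous_snd
  convert (isClosed_exists_compact (isOpen_nonconst.preimage hc).isClosed_compl).isOpen_compl using 1
  ext p
  simp [rotSet]

/-- If the segment meets the diagonal, the two differences are positive multiples of each other. The
two configurations then have the same order on some arm, and `noCollision_of_pos` excludes a
collision. -/
theorem mem_rotSet_of_collision {x y : Conf2 (YGraph ℓ)} (h : ¬ NoCollision x y) :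
    (x, y) ∈ rotSet ℓ := by
  intro u
  by_contra hcon
  refine h ?_
  simp only [Nonconst, not_or, not_not] at hcon
  have h0 := u.2.1
  have h1 := sub_nonneg.2 u.2.2
  set c := seg (-confDiff x) (confDiff y) u 0 with hc
  have hk : ∀ k, seg (-confDiff x) (confDiff y) u k = c := fun k => by
    fin_cases k
    · rfl
    · exact hcon.1.symm
    · exact (hcon.1.trans hcon.2).symm
  have e : (fun k => (u : ℝ) * confDiff y k) = fun k => (1 - u) * confDiff x k + c := by
    funext k
    rw [← hk k]
    simp only [seg, Pi.neg_apply]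
    ring
  -- Both differences have median `0`, so taking medians in `e` shows that proportionality modulo
  -- the diagonal is proportionality.
  have hc0 : c = 0 := by
    have := congrArg med e
    rw [med_smul h0, med_add_const (fun k => (1 - (u : ℝ)) * confDiff x k), med_smul h1,
      med_confDiff, med_confDiff] at this
    linarith
  have e' : ∀ k, (u : ℝ) * confDiff y k = (1 - u) * confDiff x k := fun k => by
    have := congrFun e k
    simpa [hc0] using this
  have hu0 : 0 < (u : ℝ) := by
    rcases h0.eq_or_lt with h | h
    · obtain ⟨i, hi⟩ := exists_coord_lt x
      have := e' i
      rw [← h, zero_mul, sub_zero, one_mul] at this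
      rcases hi with hi | hi
      · exact absurd this.symm (sub_pos.2 hi).ne'
      · exact absurd this.symm (sub_neg.2 hi).ne
    · exact h
  have hu1 : 0 < 1 - (u : ℝ) := by
    rcases h1.eq_or_lt with h | h
    · obtain ⟨i, hi⟩ := exists_coord_lt y
      have := e' i
      rw [← h, zero_mul] at this
      rcases hi with hi | hi
      · exact absurd this (mul_pos hu0 (sub_pos.2 hi)).ne'
      · exact absurd this (mul_neg_of_pos_of_neg hu0 (sub_neg.2 hi)).ne
    · exact h
  obtain ⟨i, hi | hi⟩ := exists_coord_lt x
  · refine noCollision_of_pos hi (sub_pos.1 (?_ : 0 < confDiff y i))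
    refine pos_of_mul_pos_right ?_ h0
    rw [e']
    exact mul_pos hu1 (sub_pos.2 hi)
  · refine noCollision_swap.1 (noCollision_of_pos (i := i) hi (sub_neg.1 (?_ : confDiff y i < 0)))
    refine neg_of_mul_neg_right ?_ h0
    rw [e']
    exact mul_neg_of_pos_of_neg hu1 (sub_neg.2 hi)

end Fold

/-! ### Continuous choices of paths of finite length. -/

section Plan

/-- Paths of finite length between given families of points, depending continuously on the
parameter. -/
def HasRectPlan {ι X : Type*} [TopologicalSpace ι] [PseudoEMetricSpace X] (p q : ι → X) : Prop :=
  ∃ γ : ∀ e, Path (p e) (q e), Continuous ↿γ ∧ ∀ e, pathLength (γ e) ≠ ⊤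

theorem HasRectPlan.trans {ι X : Type*} [TopologicalSpace ι] [PseudoEMetricSpace X] {p q r : ι → X}
    (h : HasRectPlan p q) (h' : HasRectPlan q r) : HasRectPlan p r := by
  obtain ⟨γ, hγ, hl⟩ := h
  obtain ⟨γ', hγ', hl'⟩ := h'
  exact ⟨fun e => (γ e).trans (γ' e), Path.trans_continuous_family γ hγ γ' hγ', fun e =>
    ne_top_of_le_ne_top (ENNReal.add_ne_top.2 ⟨hl e, hl' e⟩) (pathLength_trans_le _ _)⟩

variable {ℓ : Fin 3 → ℝ} [hℓ : Fact (∀ i, 0 < ℓ i)]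

theorem hasRectPlan_of_lipschitz {ι : Type*} [TopologicalSpace ι] {f : ι → I → Conf2 (YGraph ℓ)}
    (hf : Continuous fun p : ι × I => f p.1 p.2) (hl : ∀ e, ∃ K, LipschitzWith K (f e)) :
    HasRectPlan (fun e => toIntrinsic (f e 0)) (fun e => toIntrinsic (f e 1)) := by
  refine ⟨fun e => ⟨⟨fun u => toIntrinsic (f e u), continuous_toIntrinsic.comp
    (hf.comp (Continuous.prodMk_right e))⟩, rfl, rfl⟩, continuous_toIntrinsic.comp hf, fun e => ?_⟩
  obtain ⟨K, hK⟩ := hl e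
  have hK' := lipschitzWith_intrinsic hK
  exact ne_top_of_le_ne_top ENNReal.coe_ne_top (pathLength_le_of_lipschitz hK')

theorem continuous_confGeod {ι : Type*} [TopologicalSpace ι] {x y : ι → Conf2 (YGraph ℓ)}
    (hx : Continuous x) (hy : Continuous y) (h : ∀ e, NoCollision (x e) (y e)) :
    Continuous fun p : ι × I => confGeod (h p.1) p.2 :=
  continuous_mkConf
    (continuous_geod_comp (continuous_conf_fst.comp (hx.comp continuous_fst))
      (continuous_conf_fst.comp (hy.comp continuous_fst)) continuous_snd)
    (continuous_geod_comp (continuous_conf_snd.comp (hx.comp continuous_fst))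
      (continuous_conf_snd.comp (hy.comp continuous_fst)) continuous_snd) _

theorem hasRectPlan_confGeod {ι : Type*} [TopologicalSpace ι] {x y : ι → Conf2 (YGraph ℓ)}
    (hx : Continuous x) (hy : Continuous y) (h : ∀ e, NoCollision (x e) (y e)) :
    HasRectPlan (fun e => toIntrinsic (x e)) (fun e => toIntrinsic (y e)) := by
  have := hasRectPlan_of_lipschitz (continuous_confGeod hx hy h)
    fun e => ⟨_, lipschitzWith_confGeod (h e)⟩
  simpa only [confGeod_zero, confGeod_one] using this

theorem seg_zero (z w : Fin 3 → ℝ) : seg z w 0 = z := by funext k; simp [seg]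

theorem seg_one (z w : Fin 3 → ℝ) : seg z w 1 = w := by funext k; simp [seg]

theorem hasRectPlan_seg {ι : Type*} [TopologicalSpace ι] {z w : ι → Fin 3 → ℝ}
    (hz : Continuous z) (hw : Continuous w) (hz' : ∀ e, Nonconst (z e)) (hw' : ∀ e, Nonconst (w e))
    (h : ∀ e u, Nonconst (seg (z e) (w e) u)) :
    HasRectPlan (fun e => toIntrinsic (foldConf ℓ (z e) (hz' e)))
      (fun e => toIntrinsic (foldConf ℓ (w e) (hw' e))) := by
  have := hasRectPlan_of_lipschitz (f := fun e u => foldConf ℓ (seg (z e) (w e) u) (h e u))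
    (continuous_foldConf (continuous_seg (hz.comp continuous_fst) (hw.comp continuous_fst)
      continuous_snd) fun p => h p.1 p.2)
    fun e => ⟨Real.toNNReal (dist (z e) (w e) * √(6 ^ 2 + 6 ^ 2)),
      LipschitzWith.of_dist_le_mul fun u v => by
        rw [Real.coe_toNNReal _ (by positivity)]
        refine (dist_foldConf_le _ _).trans ?_
        rw [mul_right_comm]
        refine mul_le_mul_of_nonneg_right ?_ (Real.sqrt_nonneg _)
        rw [mul_comm]
        exact dist_seg_le _ _ _ _⟩
  simpa only [seg_zero, seg_one] using this

/-- A continuous choice of paths of finite length on `rotSet`: turn the difference of the two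
points to its opposite in a fixed direction, and then move on along a segment. -/
theorem hasRectPlan_rotSet {ι : Type*} [TopologicalSpace ι] {x y : ι → Conf2 (YGraph ℓ)}
    (hx : Continuous x) (hy : Continuous y) (h : ∀ e, (x e, y e) ∈ rotSet ℓ) :
    HasRectPlan (fun e => toIntrinsic (x e)) (fun e => toIntrinsic (y e)) := by
  have d1 := (continuous_confDiff (ℓ := ℓ)).comp hx
  have d2 := (continuous_confDiff (ℓ := ℓ)).comp hy
  have n1 := fun e => nonconst_confDiff (x e)
  have n2 := fun e => nonconst_confDiff (y e)
  have n3 : ∀ e, Nonconst (rot (confDiff (x e))) := fun e => by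
    simpa only [seg_one] using nonconst_seg_rot (n1 e) 1
  have n4 : ∀ e, Nonconst (-(confDiff (x e))) := fun e => by
    simpa only [seg_one] using nonconst_seg_rot_neg (n1 e) 1
  -- Fold `x`, turn its direction by 120 and then 60 degrees to the opposite one, follow the segment
  -- to the direction of `y`, and unfold to `y`.
  exact ((((hasRectPlan_confGeod hx (continuous_foldConf d1 n1)
    fun e => noCollision_foldConf (x e)).trans
    (hasRectPlan_seg d1 (continuous_rot.comp d1) n1 n3 fun e => nonconst_seg_rot (n1 e))).trans
    (hasRectPlan_seg (continuous_rot.comp d1) d1.neg n3 n4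
      fun e => nonconst_seg_rot_neg (n1 e))).trans
    (hasRectPlan_seg d1.neg d2 n4 n2 fun e => h e)).trans
    (hasRectPlan_confGeod (continuous_foldConf d2 n2) hy fun e => (noCollision_foldConf (y e)).symm)

end Plan

/-! ### Near-geodesic motion planning on the two sets of the partition. -/

section NearGeodesic
variable {ℓ : Fin 3 → ℝ} [hℓ : Fact (∀ i, 0 < ℓ i)]

/-- A point of the space with the intrinsic metric, as a configuration. -/
def fromIntrinsic (x : Intrinsic (Conf2 (YGraph ℓ))) : Conf2 (YGraph ℓ) := x

theorem continuous_fromIntrinsic :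
    Continuous (fromIntrinsic : Intrinsic (Conf2 (YGraph ℓ)) → _) := (intrinsicHomeo ℓ).continuous_symm

theorem continuous_toCompletion : Continuous (toCompletion : Conf2 (YGraph ℓ) → _) :=
  (UniformSpace.Completion.continuous_coe _).comp continuous_toIntrinsic

theorem lipschitzWith_toCompletion_confGeod {x y : Conf2 (YGraph ℓ)} (h : NoCollision x y) :
    LipschitzWith (nndist (toIntrinsic x) (toIntrinsic y)) fun u => toCompletion (confGeod h u) := by
  have hl := lipschitzWith_intrinsic (lipschitzWith_confGeod h)
  refine LipschitzWith.of_dist_le_mul fun u w => ?_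
  rw [dist_toCompletion, coe_nndist, dist_toIntrinsic h]
  exact hl.dist_le_mul u w

theorem edist_toCompletion (x y : Conf2 (YGraph ℓ)) :
    edist (toCompletion x) (toCompletion y) = edist (toIntrinsic x) (toIntrinsic y) := by
  rw [edist_dist, edist_dist, dist_toCompletion]

theorem pathLength_confGeod {x y : Conf2 (YGraph ℓ)} (h : NoCollision x y) :
    pathLength (fun u => toCompletion (confGeod h u)) = edist (toCompletion x) (toCompletion y) := by
  refine le_antisymm ?_ ?_
  · refine (pathLength_le_of_lipschitz (lipschitzWith_toCompletion_confGeod h)).trans ?_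
    rw [edist_toCompletion, edist_nndist]
  · have := edist_le_pathLength fun u => toCompletion (confGeod h u)
    rwa [confGeod_zero, confGeod_one] at this

theorem pathLength_toIntrinsic_confGeod {x y : Conf2 (YGraph ℓ)} (h : NoCollision x y) :
    pathLength (fun u => toIntrinsic (confGeod h u)) = edist (toIntrinsic x) (toIntrinsic y) := by
  rw [← edist_toCompletion, ← pathLength_confGeod h]
  unfold pathLength eVariationOn
  simp only [edist_toCompletion]

/-- The pairs of configurations without collision. -/
def noCollisionSet (ℓ : Fin 3 → ℝ) [Fact (∀ i, 0 < ℓ i)] :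
    Set (Intrinsic (Conf2 (YGraph ℓ)) × Intrinsic (Conf2 (YGraph ℓ))) :=
  {p | NoCollision (fromIntrinsic p.1) (fromIntrinsic p.2)}

theorem isOpen_noCollisionSet : IsOpen (noCollisionSet ℓ) :=
  isOpen_noCollision.preimage (continuous_fromIntrinsic.prodMap continuous_fromIntrinsic)

/-- The straight motion is already a geodesic in the space, so the near-geodesic can be constant in
its parameter. -/
theorem exists_ngmpr_noCollisionSet : ∃ Φ, IsNGMPR (noCollisionSet ℓ) Φ := by
  have hnc : ∀ e : noCollisionSet ℓ, NoCollision (fromIntrinsic e.1.1) (fromIntrinsic e.1.2) :=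
    fun e => e.2
  let g : C((noCollisionSet ℓ × I) × I, ConfCompletion ℓ) :=
    ⟨fun p => toCompletion (confGeod (hnc p.1.1) p.2), continuous_toCompletion.comp
      ((continuous_confGeod (continuous_fromIntrinsic.comp (by fun_prop))
        (continuous_fromIntrinsic.comp (by fun_prop)) hnc).comp
        (by fun_prop : Continuous fun p : (noCollisionSet ℓ × I) × I => (p.1.1, p.2)))⟩
  refine ⟨g.curry.curry, fun e => ?_⟩
  have hg : ∀ s : I, (g.curry.curry e s : I → _) = fun u => toCompletion (confGeod (hnc e) u) :=
    fun s => rfl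
  have hj : Joins (⟨fun u => toIntrinsic (confGeod (hnc e) u), continuous_toIntrinsic.comp
      (lipschitzWith_confGeod (hnc e)).continuous⟩ : C(I, _)) e.1.1 e.1.2 :=
    ⟨congrArg toIntrinsic (confGeod_zero (hnc e)), congrArg toIntrinsic (confGeod_one (hnc e))⟩
  refine ⟨⟨fun s => ⟨?_, ?_⟩, ?_, fun s _ => ⟨_, hj, fun t => rfl⟩, fun u _ => ?_⟩, fun _ =>
    ⟨_, hj, ?_, fun t => rfl⟩⟩
  · exact congrArg toCompletion (confGeod_zero (hnc e))
  · exact congrArg toCompletion (confGeod_one (hnc e))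
  · rw [IsGeodesic, hg, pathLength_confGeod]
    simp only [confGeod_zero, confGeod_one]
  · simp only [hg]
    exact tendsto_const_nhds
  · have := pathLength_toIntrinsic_confGeod (hnc e)
    rw [IsGeodesic, hj.1, hj.2]
    exact this

/-- The radial path towards the cone point, up to the parameter `s`. -/
noncomputable def shrinkPath (s : I) (x : Conf2 (YGraph ℓ)) :
    Path (toCompletion x) (coneMap s x) where
  toFun t := coneMap (segPoint 1 s t) x
  continuous_toFun := continuous_coneMap.comp
    (((lipschitzWith_segPoint 1 s).continuous).prodMk continuous_const)
  source' := by
    rw [← coneMap_one]; congr 1; exact Subtype.ext (by simp [segPoint])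
  target' := by
    congr 1; exact Subtype.ext (by simp [segPoint])

theorem shrinkPath_apply (s : I) (x : Conf2 (YGraph ℓ)) (t : I) :
    shrinkPath s x t = coneMap (segPoint 1 s t) x := rfl

theorem pathLength_shrinkPath_le (s : I) (x : Conf2 (YGraph ℓ)) :
    pathLength (shrinkPath s x) ≤ ENNReal.ofReal (confRadius x) := by
  refine pathLength_le_of_lipschitz (LipschitzWith.of_dist_le_mul fun t t' => ?_)
  rw [shrinkPath_apply, shrinkPath_apply, Real.coe_toNNReal _ (confRadius_nonneg x)]
  refine (dist_coneMap_le _ _ _ _).trans ?_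
  rw [dist_self, mul_zero, add_zero, mul_comm]
  refine mul_le_mul_of_nonneg_left ?_ (confRadius_nonneg x)
  have h := (lipschitzWith_segPoint 1 s).dist_le_mul t t'
  rw [Subtype.dist_eq, Real.dist_eq] at h
  refine h.trans (mul_le_of_le_one_left dist_nonneg ?_)
  rw [Real.coe_nnabs]
  exact abs_le.2 ⟨by simpa using s.2.1, by simpa using s.2.2.trans (by norm_num)⟩

theorem lipschitzWith_coneMap (s : I) : LipschitzWith (Real.toNNReal s)
    fun x : Intrinsic (Conf2 (YGraph ℓ)) => coneMap s (fromIntrinsic x) := by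
  refine LipschitzWith.of_dist_le_mul fun x y => ?_
  rw [Real.coe_toNNReal _ s.2.1]
  refine (dist_coneMap_le s s _ _).trans (le_of_eq ?_)
  rw [sub_self, abs_zero, zero_mul, zero_add]
  rfl

/-- A path, contracted towards the cone point. -/
noncomputable def contractPath (s : I) {x y : Conf2 (YGraph ℓ)}
    (η : Path (toIntrinsic x) (toIntrinsic y)) : Path (coneMap s x) (coneMap s y) where
  toFun t := coneMap s (fromIntrinsic (η t))
  continuous_toFun := (lipschitzWith_coneMap s).continuous.comp η.continuous
  source' := by rw [η.source]; rfl
  target' := by rw [η.target]; rfl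

/-- The path which shrinks `x` towards the cone point up to the parameter `s`, follows a shrunk
copy of the path `η`, and expands again to `y`. -/
noncomputable def detour (s : I) {x y : Conf2 (YGraph ℓ)}
    (η : Path (toIntrinsic x) (toIntrinsic y)) : Path (toCompletion x) (toCompletion y) :=
  ((shrinkPath s x).trans (contractPath s η)).trans (shrinkPath s y).symm

/-- The rays contribute at most the radii and the middle part is scaled by `s`. Hence the excess
over the sum of the radii tends to `0` when `η` has finite length. -/
theorem pathLength_detour_le (s : I) {x y : Conf2 (YGraph ℓ)}
    (η : Path (toIntrinsic x) (toIntrinsic y)) : pathLength (detour s η) ≤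
      ENNReal.ofReal (confRadius x) + ENNReal.ofReal s * pathLength η +
        ENNReal.ofReal (confRadius y) := by
  refine (pathLength_trans_le _ _).trans (add_le_add ((pathLength_trans_le _ _).trans
    (add_le_add (pathLength_shrinkPath_le s x) ?_)) ?_)
  · exact (lipschitzWith_coneMap s).lipschitzOnWith.comp_eVariationOn_le (mapsTo_univ _ univ)
  · rw [pathLength_symm]; exact pathLength_shrinkPath_le s y

theorem coneMap_mem_range {s : I} (hs : 0 < s) (x : Conf2 (YGraph ℓ)) :
    coneMap s x ∈ range ((↑) : Intrinsic (Conf2 (YGraph ℓ)) → ConfCompletion ℓ) := by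
  rw [coneMap_of_pos hs]; exact mem_range_self _

theorem detour_mem_range {s : I} (hs : 0 < s) {x y : Conf2 (YGraph ℓ)}
    (η : Path (toIntrinsic x) (toIntrinsic y)) (t : I) :
    detour s η t ∈ range ((↑) : Intrinsic (Conf2 (YGraph ℓ)) → ConfCompletion ℓ) := by
  have key : range (detour s η) ⊆
      range ((↑) : Intrinsic (Conf2 (YGraph ℓ)) → ConfCompletion ℓ) := by
    have hseg : ∀ t, 0 < (segPoint 1 s t : I) := fun t => by
      have hs' : 0 < (s : ℝ) := hs
      have h0 := t.2.1
      have h1 := sub_nonneg.2 t.2.2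
      change (0 : ℝ) < (1 - t) * 1 + t * s
      rcases h0.eq_or_lt with h | h
      · rw [← h]; norm_num
      · nlinarith [mul_pos h hs']
    rw [detour, Path.trans_range, Path.trans_range, Path.symm_range]
    refine union_subset (union_subset ?_ ?_) ?_
    · rintro _ ⟨t, rfl⟩; exact coneMap_mem_range (hseg t) _
    · rintro _ ⟨t, rfl⟩; exact coneMap_mem_range hs _
    · rintro _ ⟨t, rfl⟩; exact coneMap_mem_range (hseg t) _
  exact key (mem_range_self t)

theorem continuous_detour {ι : Type*} [TopologicalSpace ι] {x y : ι → Conf2 (YGraph ℓ)}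
    (hx : Continuous x) (hy : Continuous y) (η : ∀ e, Path (toIntrinsic (x e)) (toIntrinsic (y e)))
    (hη : Continuous ↿η) : Continuous fun p : (ι × I) × I => detour p.1.2 (η p.1.1) p.2 := by
  have hs : ∀ {x : ι → Conf2 (YGraph ℓ)}, Continuous x →
      Continuous ↿(fun p : ι × I => shrinkPath p.2 (x p.1)) := fun {x} hx => by
    refine continuous_coneMap.comp (Continuous.prodMk ?_ (hx.comp (by fun_prop)))
    refine Continuous.subtype_mk ?_ _
    fun_prop
  have hm : Continuous ↿(fun p : ι × I => contractPath p.2 (η p.1)) := by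
    refine continuous_coneMap.comp (Continuous.prodMk (by fun_prop) ?_)
    exact continuous_fromIntrinsic.comp (hη.comp
      (by fun_prop : Continuous fun p : (ι × I) × I => (p.1.1, p.2)))
  exact Path.trans_continuous_family _ (Path.trans_continuous_family _ (hs hx) _ hm) _
    (Path.symm_continuous_family _ (hs hy))

theorem exists_ngmpr_compl : ∃ Φ, IsNGMPR (noCollisionSet ℓ)ᶜ Φ := by
  have hx : Continuous fun e : ↥(noCollisionSet ℓ)ᶜ => fromIntrinsic e.1.1 :=
    continuous_fromIntrinsic.comp (by fun_prop)
  have hy : Continuous fun e : ↥(noCollisionSet ℓ)ᶜ => fromIntrinsic e.1.2 :=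
    continuous_fromIntrinsic.comp (by fun_prop)
  obtain ⟨η, hη, hl⟩ := hasRectPlan_rotSet hx hy fun e => mem_rotSet_of_collision e.2
  let g : C((↥(noCollisionSet ℓ)ᶜ × I) × I, ConfCompletion ℓ) :=
    ⟨fun p => detour p.1.2 (η p.1.1) p.2, continuous_detour hx hy η hη⟩
  refine ⟨g.curry.curry, fun e => ?_⟩
  have hg : ∀ s : I, (g.curry.curry e s : I → _) = detour s (η e) := fun s => rfl
  have hd : edist (toCompletion (fromIntrinsic e.1.1)) (toCompletion (fromIntrinsic e.1.2)) =
      ENNReal.ofReal (confRadius (fromIntrinsic e.1.1)) +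
        ENNReal.ofReal (confRadius (fromIntrinsic e.1.2)) := by
    rw [← ENNReal.ofReal_add (confRadius_nonneg _) (confRadius_nonneg _), edist_dist,
      dist_toCompletion, dist_toIntrinsic_of_collision e.2]
  have hge : ∀ s, ENNReal.ofReal (confRadius (fromIntrinsic e.1.1)) +
        ENNReal.ofReal (confRadius (fromIntrinsic e.1.2)) ≤ pathLength (detour s (η e)) := fun s => by
    rw [← hd]
    have := edist_le_pathLength (detour s (η e))
    rwa [Path.source, Path.target] at this
  have hle := fun s => pathLength_detour_le s (η e)
  -- At `s = 0` the middle part rests at the cone point and the detour is a geodesic of the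
  -- completion.
  have h0 : pathLength (detour 0 (η e)) = ENNReal.ofReal (confRadius (fromIntrinsic e.1.1)) +
        ENNReal.ofReal (confRadius (fromIntrinsic e.1.2)) := by
    refine le_antisymm ((hle 0).trans (le_of_eq ?_)) (hge 0)
    simp
  refine ⟨⟨fun s => ⟨?_, ?_⟩, ?_, fun s hs => ?_, fun u hu => ?_⟩, ?_⟩
  · rw [hg, Path.source]; rfl
  · rw [hg, Path.target]; rfl
  · rw [IsGeodesic, hg, h0, Path.source, Path.target, hd]
  · choose γ hγ using detour_mem_range hs (η e)
    have hc : Continuous γ := by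
      rw [(UniformSpace.Completion.isUniformInducing_coe _).isInducing.continuous_iff]
      convert (detour s (η e)).continuous using 1
      exact funext hγ
    refine ⟨⟨γ, hc⟩, ⟨?_, ?_⟩, fun t => (hγ t).symm⟩
    · refine UniformSpace.Completion.coe_injective _ ?_
      change ((γ 0 : _) : ConfCompletion ℓ) = _
      rw [hγ, Path.source]; rfl
    · refine UniformSpace.Completion.coe_injective _ ?_
      change ((γ 1 : _) : ConfCompletion ℓ) = _
      rw [hγ, Path.target]; rfl
  · simp only [hg, h0]
    refine tendsto_of_tendsto_of_tendsto_of_le_of_le tendsto_const_nhds ?_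
      (fun n => hge (u n)) (fun n => hle (u n))
    have h1 : Tendsto (fun n => ENNReal.ofReal (u n : ℝ) * pathLength (η e)) atTop (𝓝 0) := by
      have h2 : Tendsto (fun n => ENNReal.ofReal (u n : ℝ)) atTop (𝓝 0) := by
        have := ENNReal.tendsto_ofReal ((continuous_subtype_val.tendsto (0 : I)).comp hu)
        simpa using this
      simpa using ENNReal.Tendsto.mul_const h2 (Or.inr (hl e))
    simpa using (tendsto_const_nhds.add h1).add tendsto_const_nhds
  -- The condition on geodesics in the space is vacuous here: by the strictness of `lt_pathLength`,
  -- no path between colliding configurations has length equal to their intrinsic distance.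
  · rintro ⟨γ, ⟨hγ0, hγ1⟩, hγ⟩
    exfalso
    have hLip : LipschitzWith 1 (fromIntrinsic : Intrinsic (Conf2 (YGraph ℓ)) → _) :=
      LipschitzWith.of_dist_le_mul fun x y => by
        rw [NNReal.coe_one, one_mul]; exact toIntrinsic_dist_ge _ _
    let p : Path (fromIntrinsic e.1.1) (fromIntrinsic e.1.2) :=
      ⟨⟨fun t => fromIntrinsic (γ t), hLip.continuous.comp γ.continuous⟩,
        congrArg fromIntrinsic hγ0, congrArg fromIntrinsic hγ1⟩
    have h1 : pathLength p ≤ pathLength γ := by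
      have := (hLip.lipschitzOnWith (s := univ)).comp_eVariationOn_le (g := γ) (mapsTo_univ _ univ)
      rwa [ENNReal.coe_one, one_mul] at this
    have h2 := lt_pathLength p e.2
    rw [hγ, hγ0, hγ1] at h1
    have h3 : edist e.1.1 e.1.2 = ENNReal.ofReal (confRadius (fromIntrinsic e.1.1) +
        confRadius (fromIntrinsic e.1.2)) := by
      rw [edist_dist]
      exact congrArg _ (dist_toIntrinsic_of_collision e.2)
    rw [h3] at h1
    exact absurd h2 h1.not_gt

end NearGeodesic

/-! ### The completion is compact and geodesic. -/

section Compactness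

theorem isGeodesic_of_lipschitz {X : Type*} [PseudoMetricSpace X] {γ : C(I, X)} {x y : X}
    (h : Joins γ x y) (hl : LipschitzWith (nndist x y) γ) : IsGeodesic γ := by
  refine le_antisymm ((pathLength_le_of_lipschitz hl).trans ?_) (edist_le_pathLength γ)
  rw [h.1, h.2, edist_nndist]

/-- In a compact space it suffices to join the points of a dense subset by geodesics. -/
theorem isGeodesicSpace_of_dense {X : Type*} [MetricSpace X] [CompactSpace X] {S : Set X}
    (hS : Dense S) (h : ∀ x ∈ S, ∀ y ∈ S, ∃ γ : I → X,
      LipschitzWith (nndist x y) γ ∧ γ 0 = x ∧ γ 1 = y) : IsGeodesicSpace X := by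
  intro x y
  obtain ⟨a, ha, hax⟩ := mem_closure_iff_seq_limit.1 (hS x)
  obtain ⟨b, hb, hby⟩ := mem_closure_iff_seq_limit.1 (hS y)
  choose γ hl h0 h1 using fun n => h (a n) (ha n) (b n) (hb n)
  -- Pointwise limits along an ultrafilter exist by compactness. The Lipschitz constants converge to
  -- the distance of the endpoints, so the limit is again a geodesic.
  have hle : (hyperfilter ℕ : Filter ℕ) ≤ atTop := Nat.hyperfilter_le_atTop
  have hlim : ∀ t, ∃ z, Tendsto (fun n => γ n t) (hyperfilter ℕ) (𝓝 z) := fun t =>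
    ⟨_, ((hyperfilter ℕ).map fun n => γ n t).le_nhds_lim⟩
  choose γ' hγ' using hlim
  have hL : LipschitzWith (nndist x y) γ' := by
    refine LipschitzWith.of_dist_le_mul fun t u => ?_
    refine le_of_tendsto_of_tendsto ((hγ' t).dist (hγ' u))
      (((hax.dist hby).mono_left hle).mul_const (dist t u)) (Eventually.of_forall fun n => ?_)
    exact (hl n).dist_le_mul t u
  have hj : Joins (⟨γ', hL.continuous⟩ : C(I, X)) x y := by
    refine ⟨tendsto_nhds_unique (hγ' 0) ?_, tendsto_nhds_unique (hγ' 1) ?_⟩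
    · simp only [h0]; exact hax.mono_left hle
    · simp only [h1]; exact hby.mono_left hle
  exact ⟨_, hj, isGeodesic_of_lipschitz hj hL⟩

theorem abs_sub_mul (a b : ℝ) {c : ℝ} (hc : 0 ≤ c) : |a - b| * c = |a * c - b * c| := by
  rw [← sub_mul, abs_mul, abs_of_nonneg hc]

variable {ℓ : Fin 3 → ℝ}

instance : CompactSpace (YGraph ℓ) := by
  have h : (univ : Set (YGraph ℓ)) = ⋃ i, range (armPoint i) := by
    refine (eq_univ_of_forall fun a => ?_).symm
    obtain ⟨x, i, s, hs, rfl⟩ := a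
    exact mem_iUnion.2 ⟨i, ⟨s, hs⟩, rfl⟩
  refine ⟨h ▸ isCompact_iUnion fun i => isCompact_range (continuous_of_coord fun k => ?_)⟩
  by_cases hk : k = i
  · subst hk; simp only [armPoint_apply_self]; fun_prop
  · simp only [armPoint_apply_ne hk]; fun_prop

instance : CompactSpace (WithLp 2 (YGraph ℓ × YGraph ℓ)) :=
  (WithLp.homeomorphProd 2 (YGraph ℓ) (YGraph ℓ)).symm.compactSpace

instance : LocallyCompactSpace (Conf2 (YGraph ℓ)) :=
  (isOpen_ne_fun (WithLp.continuous_fst 2 _ _) (WithLp.continuous_snd 2 _ _)).locallyCompactSpace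

variable [hℓ : Fact (∀ i, 0 < ℓ i)]

/-- On such a set the intrinsic metric is that of the compact product of two copies of the graph. -/
theorem totallyBounded_of_noCollision {C : Set (Conf2 (YGraph ℓ))}
    (hC : ∀ x ∈ C, ∀ y ∈ C, NoCollision x y) : TotallyBounded (toIntrinsic '' C) := by
  have h1 : TotallyBounded (univ : Set C) := by
    have hi : IsUniformInducing fun x : C => x.1.1 :=
      (isometry_subtype_coe.comp isometry_subtype_coe).isUniformInducing
    simpa using totallyBounded_preimage hi
      (isCompact_univ (X := WithLp 2 (YGraph ℓ × YGraph ℓ))).totallyBounded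
  have h2 : Isometry fun x : C => toIntrinsic x.1 := Isometry.of_dist_eq fun x y =>
    dist_toIntrinsic (hC x x.2 y y.2)
  have h3 := h1.image h2.uniformContinuous
  rwa [image_univ, ← image_eq_range] at h3

/-- Prescribing an arm and the strict order of the coordinates on it gives six sets, each free of
collisions, which cover all configurations. -/
theorem totallyBounded_intrinsic : TotallyBounded (univ : Set (Intrinsic (Conf2 (YGraph ℓ)))) := by
  have h : (univ : Set (Intrinsic (Conf2 (YGraph ℓ)))) ⊆
      ⋃ i : Fin 3, toIntrinsic '' {x : Conf2 (YGraph ℓ) | x.1.snd.1 i < x.1.fst.1 i} ∪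
        toIntrinsic '' {x : Conf2 (YGraph ℓ) | x.1.fst.1 i < x.1.snd.1 i} := fun x _ => by
    obtain ⟨i, hi | hi⟩ := exists_coord_lt (fromIntrinsic x)
    · exact mem_iUnion.2 ⟨i, Or.inl ⟨_, hi, rfl⟩⟩
    · exact mem_iUnion.2 ⟨i, Or.inr ⟨_, hi, rfl⟩⟩
  refine TotallyBounded.subset h (totallyBounded_iUnion.2 fun i => TotallyBounded.union ?_ ?_)
  · exact totallyBounded_of_noCollision fun x hx y hy => noCollision_of_pos hx hy
  · exact totallyBounded_of_noCollision fun x hx y hy =>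
      noCollision_swap.1 (noCollision_of_pos (i := i) hx hy)

instance : CompactSpace (ConfCompletion ℓ) := by
  have h := (totallyBounded_intrinsic (ℓ := ℓ)).image
    (UniformSpace.Completion.uniformContinuous_coe _)
  rw [image_univ] at h
  have h' := h.closure
  rw [UniformSpace.Completion.denseRange_coe.closure_range] at h'
  exact ⟨isCompact_iff_totallyBounded_isComplete.2 ⟨h', isComplete_univ⟩⟩

/-- For colliding pairs, the geodesic runs at constant speed `D` along the ray of `x` into the cone
point and out along the ray of `y`, changing rays when `t * D = confRadius x`. -/
theorem exists_lipschitz_geodesic (x y : Conf2 (YGraph ℓ)) : ∃ γ : I → ConfCompletion ℓ,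
    LipschitzWith (nndist (toCompletion x) (toCompletion y)) γ ∧
      γ 0 = toCompletion x ∧ γ 1 = toCompletion y := by
  by_cases h : NoCollision x y
  · refine ⟨fun u => toCompletion (confGeod h u), ?_, congrArg _ (confGeod_zero h),
      congrArg _ (confGeod_one h)⟩
    have e : nndist (toCompletion x) (toCompletion y) = nndist (toIntrinsic x) (toIntrinsic y) :=
      NNReal.eq (dist_toCompletion x y)
    rw [e]
    exact lipschitzWith_toCompletion_confGeod h
  have hx := confRadius_pos x
  have hy := confRadius_pos y
  have hD : dist (toCompletion x) (toCompletion y) = confRadius x + confRadius y := by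
    rw [dist_toCompletion, dist_toIntrinsic_of_collision h]
  set D := confRadius x + confRadius y with hDdef
  let s : I → I := fun t => projIcc 0 1 zero_le_one (1 - t * D / confRadius x)
  let s' : I → I := fun t => projIcc 0 1 zero_le_one ((t * D - confRadius x) / confRadius y)
  have hs : ∀ t : I, t * D ≤ confRadius x → (s t : ℝ) * confRadius x = confRadius x - t * D := by
    intro t ht
    have hm : 1 - t * D / confRadius x ∈ Icc (0 : ℝ) 1 :=
      ⟨sub_nonneg.2 ((div_le_one hx).2 ht), sub_le_self _
        (div_nonneg (mul_nonneg t.2.1 (by positivity)) hx.le)⟩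
    simp only [s, projIcc_of_mem _ hm]
    field_simp
  have hs' : ∀ t : I, confRadius x ≤ t * D → (s' t : ℝ) * confRadius y = t * D - confRadius x := by
    intro t ht
    have htD : t * D ≤ D := mul_le_of_le_one_left (by positivity) t.2.2
    have hm : (t * D - confRadius x) / confRadius y ∈ Icc (0 : ℝ) 1 :=
      ⟨div_nonneg (sub_nonneg.2 ht) hy.le, (div_le_one hy).2 (by linarith)⟩
    simp only [s', projIcc_of_mem _ hm]
    field_simp
  refine ⟨fun t => if t * D ≤ confRadius x then coneMap (s t) x else coneMap (s' t) y, ?_, ?_, ?_⟩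
  · refine LipschitzWith.of_dist_le_mul fun t u => ?_
    wlog htu : t ≤ u generalizing t u
    · rw [dist_comm, dist_comm t]; exact this u t (le_of_not_ge htu)
    have htu' : (t : ℝ) ≤ u := htu
    have hDpos : 0 < D := by positivity
    have hmono := mul_le_mul_of_nonneg_right htu' hDpos.le
    rw [coe_nndist, hD, Subtype.dist_eq t, Real.dist_eq, abs_sub_comm,
      abs_of_nonneg (sub_nonneg.2 htu')]
    by_cases hu : u * D ≤ confRadius x
    · have ht := hmono.trans hu
      simp only [if_pos hu, if_pos ht]
      refine (dist_coneMap_le _ _ _ _).trans ?_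
      rw [dist_self, mul_zero, add_zero, abs_sub_mul _ _ hx.le, hs t ht,
        hs u hu, abs_of_nonneg] <;> linarith
    · have hu' := (not_le.1 hu).le
      by_cases ht : t * D ≤ confRadius x
      · simp only [if_neg hu, if_pos ht]
        refine (dist_triangle_left _ _ (conePoint ℓ)).trans
          ((add_le_add (dist_conePoint_le _ _) (dist_conePoint_le _ _)).trans ?_)
        rw [hs t ht, hs' u hu']
        linarith
      · have ht' := (not_le.1 ht).le
        simp only [if_neg hu, if_neg ht]
        refine (dist_coneMap_le _ _ _ _).trans ?_
        rw [dist_self, mul_zero, add_zero, abs_sub_mul _ _ hy.le,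
          hs' t ht', hs' u hu', abs_of_nonpos] <;> linarith
  · have h0 : ((0 : I) : ℝ) * D ≤ confRadius x := by simpa using hx.le
    have e : s 0 = 1 := by simp [s]
    simp only [if_pos h0, e, coneMap_one]
  · have h1 : ¬ ((1 : I) : ℝ) * D ≤ confRadius x := by simpa [hDdef] using hy
    have e : s' 1 = 1 := by simp [s', hDdef, hy.ne']
    simp only [if_neg h1, e, coneMap_one]

theorem isGeodesicSpace_completion : IsGeodesicSpace (ConfCompletion ℓ) := by
  refine isGeodesicSpace_of_dense (UniformSpace.Completion.denseRange_coe
    (α := Intrinsic (Conf2 (YGraph ℓ)))) ?_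
  rintro _ ⟨x, rfl⟩ _ ⟨y, rfl⟩
  exact exists_lipschitz_geodesic (fromIntrinsic x) (fromIntrinsic y)

end Compactness

/-! ### Winding numbers exclude a global motion plan. -/

section Winding

/-- Projection of space along the diagonal to the plane; the coordinate axes are mapped to three
axes with angles of 120 degrees. -/
noncomputable def planar (z : Fin 3 → ℝ) : ℂ := ⟨z 0 - (z 1 + z 2) / 2, √3 / 2 * (z 1 - z 2)⟩

theorem continuous_planar : Continuous planar := by
  have h : planar = fun z => Complex.equivRealProdCLM.symm
      (z 0 - (z 1 + z 2) / 2, √3 / 2 * (z 1 - z 2)) := by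
    funext z; apply Complex.ext <;> simp [planar]
  rw [h]
  fun_prop

theorem planar_ne_zero {z : Fin 3 → ℝ} (h : Nonconst z) : planar z ≠ 0 := by
  intro e
  have h1 : z 0 - (z 1 + z 2) / 2 = 0 := congrArg Complex.re e
  have h2 : √3 / 2 * (z 1 - z 2) = 0 := congrArg Complex.im e
  have h3 : z 1 - z 2 = 0 := (mul_eq_zero.1 h2).resolve_left (by positivity)
  rcases h with h | h
  · exact h (by linarith)
  · exact h (by linarith)

theorem planar_sub_const (z : Fin 3 → ℝ) (c : ℝ) : planar (fun k => z k - c) = planar z := by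
  apply Complex.ext <;> simp only [planar] <;> ring

/-- A section of `planar`. -/
noncomputable def unplanar (c : ℂ) : Fin 3 → ℝ :=
  ![2 / 3 * c.re, -c.re / 3 + c.im / √3, -c.re / 3 - c.im / √3]

theorem planar_unplanar (c : ℂ) : planar (unplanar c) = c := by
  have h : √3 ≠ 0 := by positivity
  apply Complex.ext <;> simp only [planar, unplanar, Matrix.cons_val]
  · ring
  · field_simp; ring

theorem continuous_unplanar : Continuous unplanar := by
  unfold unplanar
  refine continuous_pi fun k => ?_
  fin_cases k <;> simp <;> fun_prop

theorem nonconst_unplanar {c : ℂ} (hc : c ≠ 0) : Nonconst (unplanar c) := by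
  by_contra h
  simp only [Nonconst, not_or, not_not] at h
  refine hc ?_
  rw [← planar_unplanar c]
  apply Complex.ext <;> simp only [planar, Complex.zero_re, Complex.zero_im]
  · linarith [h.1, h.2]
  · rw [h.2, sub_self, mul_zero]

theorem abs_unplanar_le (c : ℂ) (k : Fin 3) : |unplanar c k| ≤ 2 * ‖c‖ := by
  have h1 := Complex.abs_re_le_norm c
  have h2 := Complex.abs_im_le_norm c
  have h3 : (1 : ℝ) ≤ √3 := Real.one_le_sqrt.2 (by norm_num)
  have h4 : |c.im / √3| ≤ |c.im| := by
    rw [abs_div, abs_of_pos (by positivity : 0 < √3)]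
    exact div_le_self (abs_nonneg _) h3
  rw [abs_le] at h1 h4 ⊢
  fin_cases k <;> simp [unplanar] <;> constructor <;> linarith

theorem abs_med_le {z : Fin 3 → ℝ} {c : ℝ} (h : ∀ k, |z k| ≤ c) : |med z| ≤ c := by
  have h' := fun k => abs_le.1 (h k)
  refine abs_le.2 ⟨?_, ?_⟩
  · exact le_max_of_le_left (le_min (h' 0).1 (h' 1).1)
  · exact max_le (min_le_of_left_le (h' 0).2) (min_le_of_right_le (h' 2).2)

/-- There is no continuous logarithm on the circle. -/
theorem not_exists_log_circle {κ : ℂ} (g : Circle → ℂ) (hg : Continuous g) :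
    ¬ ∀ c : Circle, Complex.exp (g c) = κ * c := by
  intro h
  -- The exponential of `g₁` is constant, hence so is `g₁`, by uniqueness of lifts. But going once
  -- around the circle changes it by `-2πi`.
  let g₁ : ℝ → ℂ := fun θ => g (Circle.exp θ) - θ * Complex.I
  have e : ∀ θ, Complex.exp (g₁ θ) = κ := fun θ => by
    rw [Complex.exp_sub, h, Circle.coe_exp, mul_div_assoc, div_self (Complex.exp_ne_zero _), mul_one]
  have h1 : g₁ = fun _ => g₁ 0 := by
    refine Complex.isCoveringMap_exp.eq_of_comp_eq ?_ continuous_const ?_ 0 rfl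
    · exact (hg.comp (Circle.exp.continuous)).sub (by fun_prop)
    · funext θ
      exact Subtype.ext ((e θ).trans (e 0).symm)
  have h2 := congrFun h1 (2 * Real.pi)
  simp only [g₁, Circle.exp_two_pi, Circle.exp_zero, Complex.ofReal_zero, zero_mul, sub_zero,
    sub_eq_self] at h2
  exact Complex.two_pi_I_ne_zero (by simpa only [Complex.ofReal_mul, Complex.ofReal_ofNat, mul_eq_zero] using h2)

variable {ℓ : Fin 3 → ℝ} [hℓ : Fact (∀ i, 0 < ℓ i)]

/-- Under this bound the truncation at the ends of the arms has no effect, and a number is the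
difference of its positive and negative parts. -/
theorem confDiff_foldConf {z : Fin 3 → ℝ} (hz : Nonconst z) (h : ∀ k, |z k - med z| ≤ ℓ k) :
    confDiff (foldConf ℓ z hz) = fun k => z k - med z := by
  funext k
  have h' := abs_le.1 (h k)
  simp only [confDiff, foldConf, mkConf_fst, mkConf_snd, foldPoint_coord, med_neg, Pi.neg_apply]
  rcases le_total 0 (z k - med z) with h0 | h0
  · rw [max_eq_left h0, min_eq_right h'.2, max_eq_right (by linarith), min_eq_right (hℓ.out k).le,
      sub_zero]
  · rw [max_eq_right h0, min_eq_right (hℓ.out k).le, max_eq_left (by linarith),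
      min_eq_right (by linarith)]
    ring

theorem not_hasMotionPlan_univ :
    ¬ HasMotionPlan (univ : Set (Conf2 (YGraph ℓ) × Conf2 (YGraph ℓ))) := by
  rintro ⟨f, hf⟩
  -- The coordinates of `unplanar (κ * c)` and their median are at most `2 * κ` in absolute value,
  -- so the excess over the median is at most `4 * κ` and fits into every arm.
  obtain ⟨κ, hκ, hκℓ⟩ : ∃ κ : ℝ, 0 < κ ∧ ∀ k, 4 * κ ≤ ℓ k := by
    obtain ⟨i, hi⟩ := Finite.exists_min ℓ
    exact ⟨ℓ i / 4, by have := hℓ.out i; positivity, fun k => by linarith [hi k]⟩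
  have hne : ∀ c : Circle, (κ * c : ℂ) ≠ 0 := fun c =>
    mul_ne_zero (Complex.ofReal_ne_zero.2 hκ.ne') c.coe_ne_zero
  let L : Circle → Conf2 (YGraph ℓ) := fun c =>
    foldConf ℓ (unplanar (κ * c)) (nonconst_unplanar (hne c))
  have hLc : Continuous L := continuous_foldConf (continuous_unplanar.comp (by fun_prop)) _
  have hL : ∀ c, planar (confDiff (L c)) = κ * c := fun c => by
    have hb : ∀ k, |unplanar (κ * c) k| ≤ 2 * κ := fun k => by
      have := abs_unplanar_le (κ * c) k
      rwa [norm_mul, Circle.norm_coe, mul_one, Complex.norm_real, Real.norm_of_nonneg hκ.le] at this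
    rw [confDiff_foldConf, planar_sub_const, planar_unplanar]
    intro k
    have h1 := hb k
    have h2 := abs_med_le hb
    exact (abs_sub _ _).trans (by linarith [hκℓ k])
  -- The plan applied to the pairs `(L 1, L c)` is a homotopy in the punctured plane from a constant
  -- to `c ↦ κ * c`. Lifting it through the exponential yields a logarithm at its end.
  let H : C(I × Circle, {z : ℂ // z ≠ 0}) :=
    ⟨fun p => ⟨planar (confDiff (f ⟨(L 1, L p.2), mem_univ _⟩ p.1)),
      planar_ne_zero (nonconst_confDiff _)⟩, by
      refine Continuous.subtype_mk (continuous_planar.comp (continuous_confDiff.comp ?_)) _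
      have : Continuous fun p : I × Circle =>
          f (⟨(L 1, L p.2), mem_univ _⟩ : (univ : Set (Conf2 (YGraph ℓ) × Conf2 (YGraph ℓ)))) :=
        f.continuous.comp (Continuous.subtype_mk (by fun_prop) _)
      exact this.eval continuous_fst⟩
  have H0 : ∀ c, H (0, c) = ⟨Complex.exp (Complex.log κ), Complex.exp_ne_zero _⟩ := fun c => by
    refine Subtype.ext ?_
    have h1 := hL 1
    rw [Circle.coe_one, mul_one] at h1
    change planar (confDiff (f ⟨(L 1, L c), mem_univ _⟩ 0)) = Complex.exp (Complex.log κ)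
    rw [(hf ⟨(L 1, L c), mem_univ _⟩).1, Complex.exp_log (Complex.ofReal_ne_zero.2 hκ.ne'), h1]
  let h := Complex.isCoveringMap_exp.liftHomotopy H (ContinuousMap.const _ (Complex.log κ)) H0
  refine not_exists_log_circle (κ := κ) (fun c => h (1, c)) (by fun_prop) fun c => ?_
  have h1 := congrFun (Complex.isCoveringMap_exp.liftHomotopy_lifts H
    (ContinuousMap.const _ (Complex.log κ)) H0) (1, c)
  have h2 : Complex.exp (h (1, c)) = planar (confDiff (f ⟨(L 1, L c), mem_univ _⟩ 1)) :=
    congrArg Subtype.val h1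
  rw [h2, (hf ⟨(L 1, L c), mem_univ _⟩).2, hL]

end Winding

/-! ### The two complexities. -/

section Complexity
variable {ℓ : Fin 3 → ℝ} [hℓ : Fact (∀ i, 0 < ℓ i)]

theorem HasRectPlan.hasMotionPlan {E : Set (Conf2 (YGraph ℓ) × Conf2 (YGraph ℓ))}
    (h : HasRectPlan (fun e : E => toIntrinsic e.1.1) fun e : E => toIntrinsic e.1.2) :
    HasMotionPlan E := by
  obtain ⟨η, hη, -⟩ := h
  let g : C(E × I, Conf2 (YGraph ℓ)) :=
    ⟨fun p => fromIntrinsic (η p.1 p.2), continuous_fromIntrinsic.comp hη⟩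
  exact ⟨g.curry, fun e => ⟨congrArg fromIntrinsic (η e).source,
    congrArg fromIntrinsic (η e).target⟩⟩

theorem noCollision_union_rotSet :
    {p : Conf2 (YGraph ℓ) × Conf2 (YGraph ℓ) | NoCollision p.1 p.2} ∪ rotSet ℓ = univ :=
  eq_univ_of_forall fun _ => or_iff_not_imp_left.2 mem_rotSet_of_collision

theorem iUnion_fin_one {X : Type*} (E : Fin (0 + 1) → Set X) : ⋃ i, E i = E 0 :=
  iUnion_eq_const fun i => congrArg E (Fin.fin_one_eq_zero i)

theorem topComplexity_conf : topComplexity (Conf2 (YGraph ℓ)) = 1 := by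
  have hle : ∃ U : Fin (1 + 1) → Set (Conf2 (YGraph ℓ) × Conf2 (YGraph ℓ)),
      (∀ i, IsOpen (U i)) ∧ (⋃ i, U i) = univ ∧ ∀ i, HasMotionPlan (U i) := by
    refine ⟨![{p | NoCollision p.1 p.2}, rotSet ℓ], ?_, ?_, ?_⟩
    · exact Fin.forall_fin_two.2 ⟨isOpen_noCollision, isOpen_rotSet⟩
    · refine eq_univ_of_forall fun p => ?_
      rcases (noCollision_union_rotSet (ℓ := ℓ)).ge (mem_univ p) with h | h
      · exact mem_iUnion.2 ⟨0, h⟩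
      · exact mem_iUnion.2 ⟨1, h⟩
    · refine Fin.forall_fin_two.2 ⟨?_, ?_⟩
      · exact (hasRectPlan_confGeod (by fun_prop) (by fun_prop) fun e => e.2).hasMotionPlan
      · exact (hasRectPlan_rotSet (by fun_prop) (by fun_prop) fun e => e.2).hasMotionPlan
  refine le_antisymm ((iInf₂_le 1 hle).trans (by simp)) (le_iInf₂ fun k hk => ?_)
  -- For `k = 0` the single set of the cover is everything.
  rcases Nat.eq_zero_or_pos k with rfl | hpos
  · obtain ⟨U, -, hU, hp⟩ := hk
    have hp0 := hp 0
    rw [iUnion_fin_one] at hU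
    rw [hU] at hp0
    exact absurd hp0 not_hasMotionPlan_univ
  · exact_mod_cast hpos

/-- At the parameter `1` a near-geodesic is a path in the space itself. The embedding into the
completion reflects continuity, so these paths form a motion plan. -/
theorem IsNGMPR.hasMotionPlan
    {Φ : C((univ : Set (Intrinsic (Conf2 (YGraph ℓ)) × Intrinsic (Conf2 (YGraph ℓ)))),
      C(I, C(I, ConfCompletion ℓ)))} (h : IsNGMPR univ Φ) :
    HasMotionPlan (univ : Set (Conf2 (YGraph ℓ) × Conf2 (YGraph ℓ))) := by
  let ι : ↥(univ : Set (Conf2 (YGraph ℓ) × Conf2 (YGraph ℓ))) →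
      (univ : Set (Intrinsic (Conf2 (YGraph ℓ)) × Intrinsic (Conf2 (YGraph ℓ)))) :=
    fun p => ⟨(toIntrinsic p.1.1, toIntrinsic p.1.2), mem_univ _⟩
  have hι : Continuous ι := Continuous.subtype_mk
    ((continuous_toIntrinsic.comp (by fun_prop)).prodMk
      (continuous_toIntrinsic.comp (by fun_prop))) _
  choose γ hγ hγ' using fun p => (h (ι p)).1.path_of_pos 1 zero_lt_one
  have hc : Continuous fun q : ↥(univ : Set (Conf2 (YGraph ℓ) × Conf2 (YGraph ℓ))) × I =>
      γ q.1 q.2 := by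
    rw [(UniformSpace.Completion.isUniformInducing_coe _).isInducing.continuous_iff]
    have e : ((↑) : Intrinsic (Conf2 (YGraph ℓ)) → ConfCompletion ℓ) ∘
        (fun q : ↥(univ : Set (Conf2 (YGraph ℓ) × Conf2 (YGraph ℓ))) × I => γ q.1 q.2) =
        fun q => Φ (ι q.1) 1 q.2 := funext fun q => (hγ' q.1 q.2).symm
    rw [e]
    have h1 : Continuous fun p => Φ (ι p) 1 := (Φ.continuous.comp hι).eval_const 1
    exact (h1.comp continuous_fst).eval continuous_snd
  let g : C(↥(univ : Set (Conf2 (YGraph ℓ) × Conf2 (YGraph ℓ))) × I, Conf2 (YGraph ℓ)) :=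
    ⟨fun q => fromIntrinsic (γ q.1 q.2), continuous_fromIntrinsic.comp hc⟩
  exact ⟨g.curry, fun p => ⟨congrArg fromIntrinsic (hγ p).1, congrArg fromIntrinsic (hγ p).2⟩⟩

theorem geodComplexity_conf : geodComplexity (Intrinsic (Conf2 (YGraph ℓ))) = 1 := by
  have : LocallyCompactSpace (Intrinsic (Conf2 (YGraph ℓ))) :=
    (intrinsicHomeo ℓ).symm.isClosedEmbedding.locallyCompactSpace
  have hle : ∃ E : Fin (1 + 1) →
      Set (Intrinsic (Conf2 (YGraph ℓ)) × Intrinsic (Conf2 (YGraph ℓ))),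
      Pairwise (fun i j => Disjoint (E i) (E j)) ∧ (⋃ i, E i) = univ ∧
      ∀ i, LocallyCompactSpace (E i) ∧ ∃ Φ, IsNGMPR (E i) Φ := by
    refine ⟨![noCollisionSet ℓ, (noCollisionSet ℓ)ᶜ], ?_, ?_, ?_⟩
    · intro i j hij
      fin_cases i <;> fin_cases j
      · exact absurd rfl hij
      · exact disjoint_compl_right
      · exact disjoint_compl_left
      · exact absurd rfl hij
    · refine eq_univ_of_forall fun p => ?_
      rcases em (p ∈ noCollisionSet ℓ) with h | h
      · exact mem_iUnion.2 ⟨0, h⟩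
      · exact mem_iUnion.2 ⟨1, h⟩
    · exact Fin.forall_fin_two.2 ⟨⟨isOpen_noCollisionSet.locallyCompactSpace,
        exists_ngmpr_noCollisionSet⟩, ⟨isOpen_noCollisionSet.isClosed_compl.locallyCompactSpace,
        exists_ngmpr_compl⟩⟩
  refine le_antisymm ((iInf₂_le 1 hle).trans (by simp)) (le_iInf₂ fun k hk => ?_)
  rcases Nat.eq_zero_or_pos k with rfl | hpos
  · obtain ⟨E, -, hE, hp⟩ := hk
    obtain ⟨-, Φ, hΦ⟩ := hp 0
    rw [iUnion_fin_one] at hE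
    revert Φ
    rw [hE]
    intro Φ hΦ
    exact absurd hΦ.hasMotionPlan not_hasMotionPlan_univ
  · exact_mod_cast hpos

end Complexity

end GeoComp

theorem theorem4p1 (ℓ : Fin 3 → ℝ) [Fact (∀ i, 0 < ℓ i)] :
    GeoComp.IsGeodesicSpace
        (UniformSpace.Completion (GeoComp.Intrinsic (GeoComp.Conf2 (GeoComp.YGraph ℓ)))) ∧
      GeoComp.geodComplexity (GeoComp.Intrinsic (GeoComp.Conf2 (GeoComp.YGraph ℓ))) = 1 ∧
      GeoComp.topComplexity (GeoComp.Conf2 (GeoComp.YGraph ℓ)) = 1 :=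
  ⟨GeoComp.isGeodesicSpace_completion, GeoComp.geodComplexity_conf, GeoComp.topComplexity_conf⟩
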